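/- Let $f$ be a real-analytic vector field near $0\in\mathbb{R}^3$ with $f(0)=0$ whose Jacobian matrix $\mathrm{D}f(0)$ has the eigenvalues $0,\pm i\omega$, $\omega>0$. Let $\alpha_1,\dots,\alpha_4\in\mathbb{R}$ be the coefficients of its Poincaré–Dulac normal form up to second order: that is, some power series change of coordinates $x=\Phi(y)$, $\Phi(0)=0$, $\det \mathrm{D}\Phi(0)\neq0$, transforms $\dot x=f(x)$ into $$\dot y_1=-\omega y_2+\alpha_1y_1y_3-\alpha_2y_2y_3,\quad \dot y_2=\omega y_1+\alpha_2y_1y_3+\alpha_1y_2y_3,\quad \dot y_3=\alpha_3(y_1^2+y_2^2)+\alpha_4y_3^2$$ up to terms of order $O(|y|^3)$ (only the terms of $\Phi$ of degree at most two matter here, so $\Phi$ may be taken convergent). Assume $(\alpha_1,\alpha_3,\alpha_4)\neq(0,0,0)$. Call a system $\dot x=g(x)$, with $g$ holomorphic near $0\in\mathbb{C}^n$, *analytically integrable near $0$* (in the Bogoyavlenskij sense) if on some neighbourhood of $0$ and for some integer $q$ with $1\le q\le n$ there are holomorphic vector fields $g_1=g,g_2,\dots,g_q$ and holomorphic functions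 $F_1,\dots,F_{n-q}$ such that (i) $g_1,\dots,g_q$ are linearly independent almost everywhere and $[g_j,g_k]:=\mathrm{D}g_k\,g_j-\mathrm{D}g_j\,g_k\equiv0$ for all $j,k$; (ii) $\mathrm{D}F_1,\dots,\mathrm{D}F_{n-q}$ are linearly independent almost everywhere and $\mathrm{D}F_k\,g_j\equiv0$ for all $j,k$. If the complexification of $\dot x=f(x)$, i.e. the system on a neighbourhood of $0\in\mathbb{C}^3$ given by the holomorphic extension of $f$, is analytically integrable near $0\in\mathbb{C}^3$, then the truncated planar system $$\dot r=\alpha_1\,r\,x_3,\qquad \dot x_3=\alpha_3\,r^2+\alpha_4\,x_3^2$$ on $\mathbb{C}^2$ is analytically integrable near $(r,x_3)=(0,0)$. -/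

import Mathlib

open Topology MeasureTheory

/-- Analytic integrability in the Bogoyavlenskij sense, near the origin of `ℂⁿ`, of the system
`ẋ = f x`.  Here `q = m + 1 ≥ 1` is the number of commuting vector fields (the first of which
is `f`) and `p = n - q` is the number of first integrals; `lieBracket` is
`[v, w] = Dw v - Dv w`. -/
def AnalyticallyIntegrableNearZero (n : ℕ) (f : (Fin n → ℂ) → (Fin n → ℂ)) : Prop :=
  ∃ (U : Set (Fin n → ℂ)) (m p : ℕ)
    (v : Fin (m + 1) → (Fin n → ℂ) → (Fin n → ℂ)) (F : Fin p → (Fin n → ℂ) → ℂ),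
    IsOpen U ∧ 0 ∈ U ∧ m + 1 + p = n ∧
    (∀ j, AnalyticOnNhd ℂ (v j) U) ∧
    (∀ k, AnalyticOnNhd ℂ (F k) U) ∧
    Set.EqOn (v 0) f U ∧
    (∀ᵐ x ∂(volume.restrict U), LinearIndependent ℂ fun j => v j x) ∧
    (∀ j k, ∀ x ∈ U, VectorField.lieBracket ℂ (v j) (v k) x = 0) ∧
    (∀ᵐ x ∂(volume.restrict U), LinearIndependent ℂ fun k => fderiv ℂ (F k) x) ∧
    (∀ j k, ∀ x ∈ U, fderiv ℂ (F k) x (v j x) = 0)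

/-- The real system `ẋ = f x` on `ℝ³` is analytic near the equilibrium `0`, and the eigenvalues
of its Jacobian matrix at `0` are `0, iω, -iω` with `ω > 0`. -/
def IsFoldHopfSystem (f : (Fin 3 → ℝ) → (Fin 3 → ℝ)) (ω : ℝ) : Prop :=
  AnalyticAt ℝ f 0 ∧ f 0 = 0 ∧ 0 < ω ∧
    ((fderiv ℝ f 0 : (Fin 3 → ℝ) →L[ℝ] (Fin 3 → ℝ)) : (Fin 3 → ℝ) →ₗ[ℝ] (Fin 3 → ℝ)).charpoly
      = Polynomial.X * (Polynomial.X ^ 2 + Polynomial.C (ω ^ 2))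

/-- The quadratic truncation of the Poincaré-Dulac normal form for the eigenvalues
`0, iω, -iω`; the coordinates `x₁, x₂, x₃` are `x 0, x 1, x 2`. -/
def truncatedNormalForm (ω α₁ α₂ α₃ α₄ : ℝ) (x : Fin 3 → ℝ) : Fin 3 → ℝ :=
  ![-ω * x 1 + α₁ * x 0 * x 2 - α₂ * x 1 * x 2,
    ω * x 0 + α₂ * x 0 * x 2 + α₁ * x 1 * x 2,
    α₃ * (x 0 ^ 2 + x 1 ^ 2) + α₄ * x 2 ^ 2]

/-- `α₁, …, α₄` are second-order normal form coefficients of `ẋ = f x` at `0`: some change of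
coordinates `x = Φ y` transforms the system into the normal form with these coefficients, up to
terms of order three.  The transformed system is `ẏ = (DΦ y)⁻¹ f(Φ y)`.  Only the terms of degree
at most two of `Φ` and of the transformed system matter, so that a formal power series `Φ` may be
replaced by its truncation. -/
def HasNormalFormCoefficients (f : (Fin 3 → ℝ) → (Fin 3 → ℝ)) (ω α₁ α₂ α₃ α₄ : ℝ) : Prop :=
  ∃ Φ : (Fin 3 → ℝ) → (Fin 3 → ℝ),
    AnalyticAt ℝ Φ 0 ∧ Φ 0 = 0 ∧ (fderiv ℝ Φ 0).IsInvertible ∧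
    (fun y => f (Φ y) - fderiv ℝ Φ y (truncatedNormalForm ω α₁ α₂ α₃ α₄ y))
      =O[𝓝 0] fun y => ‖y‖ ^ 3

/-- `fC` is the complexification of `f` near the origin: the holomorphic extension of the
real-analytic map `f` to a neighbourhood of `0` in `ℂ³`. -/
def IsComplexification (f : (Fin 3 → ℝ) → (Fin 3 → ℝ)) (fC : (Fin 3 → ℂ) → (Fin 3 → ℂ)) : Prop :=
  AnalyticAt ℂ fC 0 ∧
    ∀ᶠ x in 𝓝 (0 : Fin 3 → ℝ), fC (fun i => (x i : ℂ)) = fun i => ((f x i : ℝ) : ℂ)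

/-- The planar vector field `(α₁ r x₃, α₃ r² + α₄ x₃²)` in the variables
`(r, x₃) = (z 0, z 1) ∈ ℂ²`. -/
def truncatedPlanarField (α₁ α₃ α₄ : ℝ) (z : Fin 2 → ℂ) : Fin 2 → ℂ :=
  ![(α₁ : ℂ) * z 0 * z 1, (α₃ : ℂ) * z 0 ^ 2 + (α₄ : ℂ) * z 1 ^ 2]

/-!
Near an equilibrium with eigenvalues `0, ±iω`, integrals and commuting fields of the full system
leave a trace on the planar system through their lowest-order homogeneous parts.

A quadratic polynomial change of coordinates, the complexified two-jet of the normalizing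
transformation, turns the complexified system into `Y = S + X₂ + O(|y|³)`, where `S` is `ω` times
the infinitesimal rotation and `X₂` is the quadratic part of the normal form
(`exists_complex_normalizing_map`).  Both first integrals and commuting fields solve a linear
equation `Du · Y = B u`.  Comparing terms of the two lowest degrees `k`, `k + 1`
(`leading_relations`) shows that the lowest part `u_k` is invariant under the rotation and that the
defect of `u_k` with respect to `X₂` lies in the range of the operator defined by `S`.  The defect
is also rotation invariant, and kernel and range of an operator with periodic flow meet only in
`0`; hence the defect vanishes (`HasFPowerSeriesAt.leading_homPart_relations`).  No higher-order
normalization and no convergence statement is needed.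

Restriction of rotation-invariant objects to the plane `y₁ = 0` gives objects of the planar field
`P`, because `X₂` differs from `P` there by an infinitesimal rotation.

* If the system has a first integral, the lowest part of its nonconstant terms restricts to a
  nonconstant polynomial first integral of `P` (`planar_integrable_of_analytic_firstIntegral`).
* Otherwise there are three independent commuting fields.  Suppose that `P` is not integrable.
  Then `α₁ α₃ α₄ ≠ 0`, since for vanishing coefficients an integral or a commuting field is
  explicit.  The planar part of a lowest part `u_k` is parallel to `P`, and the components of `P`
  are coprime, so that it equals `h P` with `h` a polynomial first integral, hence a constant
  (`planar_commuting_rigidity`).  The rotational part is constant for the same reason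
  (`planar_rotational_rigidity`).  So `u_k` is a multiple of `S` or of `X₂`
  (`leading_homPart_of_commuting`), and lowest parts account for at most two dimensions, in
  contradiction to the independence of three fields (`planar_integrable_of_three_commuting`).
-/

/-! ### Growth of remainders -/

section Growth

open Asymptotics Filter

variable {V E : Type*} [NormedAddCommGroup V] [NormedSpace ℂ V]
  [NormedAddCommGroup E] [NormedSpace ℂ E]

/-- Cauchy's estimate in asymptotic form: differentiating a holomorphic germ costs one order of
vanishing. -/
theorem isBigO_fderiv_of_isBigO_norm_pow {r : V → E} {n : ℕ}
    (hd : ∀ᶠ y in 𝓝 (0 : V), DifferentiableAt ℂ r y)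
    (hr : r =O[𝓝 0] fun y => ‖y‖ ^ (n + 1)) :
    fderiv ℂ r =O[𝓝 0] fun y => ‖y‖ ^ n := by
  obtain ⟨C, hC0, hC⟩ := hr.exists_pos
  rw [isBigOWith_iff] at hC
  obtain ⟨ε, hε, hball⟩ := Metric.eventually_nhds_iff_ball.1 (hC.and hd)
  have key : ∀ y : V, ∀ R : ℝ, 0 < R → ‖y‖ + R ≤ ε →
      ‖fderiv ℂ r y‖ ≤ 3 * C * (‖y‖ + R) ^ (n + 1) / R := by
    intro y R hR hyR
    have hsub : ∀ z ∈ Metric.ball y R, ‖z‖ < ‖y‖ + R := by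
      intro z hz
      have h1 : ‖z - y‖ < R := by simpa [dist_eq_norm] using hz
      have h2 : ‖z‖ ≤ ‖y‖ + ‖z - y‖ := by
        simpa using norm_add_le y (z - y)
      linarith
    have hb : ∀ z ∈ Metric.ball y R, ‖r z‖ ≤ C * (‖y‖ + R) ^ (n + 1) := by
      intro z hz
      have hz' := hsub z hz
      have h1 := (hball z (by simpa using lt_of_lt_of_le hz' hyR)).1
      rw [Real.norm_of_nonneg (by positivity)] at h1
      exact h1.trans (by gcongr)
    have hpos : 0 < C * (‖y‖ + R) ^ (n + 1) := by positivity
    refine Complex.norm_fderiv_le_div_of_mapsTo_ball (c := y) (R₁ := R) ?_ ?_ hR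
    · intro z hz
      exact (hball z (by simpa using lt_of_lt_of_le (hsub z hz) hyR)).2.differentiableWithinAt
    · intro z hz
      rw [Metric.mem_closedBall, dist_eq_norm]
      have h1 := norm_sub_le (r z) (r y)
      have h2 := hb z hz
      have h3 := hb y (Metric.mem_ball_self hR)
      linarith
  refine IsBigO.of_bound (3 * C * 2 ^ (n + 1)) ?_
  rw [Metric.eventually_nhds_iff_ball]
  refine ⟨ε / 2, by positivity, fun y hy => ?_⟩
  have hy' : ‖y‖ < ε / 2 := by simpa using hy
  rw [Real.norm_of_nonneg (by positivity)]
  rcases eq_or_ne y 0 with rfl | hy0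
  · -- at the centre the radius is sent to zero
    have hlim : Tendsto (fun R : ℝ => 3 * C * 2 ^ (n + 1) * R ^ n) (𝓝[>] 0)
        (𝓝 (3 * C * 2 ^ (n + 1) * ‖(0 : V)‖ ^ n)) := by
      rw [norm_zero]
      refine Tendsto.mono_left ?_ nhdsWithin_le_nhds
      exact Continuous.tendsto (by fun_prop) _
    refine ge_of_tendsto hlim ?_
    filter_upwards [Ioo_mem_nhdsGT hε] with R hR
    refine (key 0 R hR.1 (by simpa using hR.2.le)).trans ?_
    rw [norm_zero, zero_add, div_le_iff₀ hR.1, mul_assoc _ (R ^ n), ← pow_succ]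
    have h1 : (1 : ℝ) ≤ 2 ^ (n + 1) := one_le_pow₀ (by norm_num)
    have h2 : 0 ≤ 3 * C * R ^ (n + 1) := by have := hR.1; positivity
    nlinarith
  · have hn : 0 < ‖y‖ := norm_pos_iff.2 hy0
    refine (key y ‖y‖ hn (by linarith)).trans (le_of_eq ?_)
    rw [← two_mul, mul_pow]
    field_simp
    ring

theorem isBigO_clm_apply {α : Type*} {l : Filter α} {D : α → V →L[ℂ] E} {w : α → V}
    {a b : α → ℂ} (hD : D =O[l] a) (hw : w =O[l] b) :
    (fun t => D t (w t)) =O[l] fun t => a t * b t := by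
  refine IsBigO.trans (g := fun t => ‖D t‖ * ‖w t‖) ?_ (hD.norm_left.mul hw.norm_left)
  refine IsBigO.of_bound 1 (Eventually.of_forall fun t => ?_)
  rw [one_mul, Real.norm_of_nonneg (by positivity)]
  exact (D t).le_opNorm _

/-- A two-term expansion in powers of `t` that vanishes to the next order has zero
coefficients. -/
theorem eq_zero_of_smul_add_smul_isBigO {a b : E} {k : ℕ}
    (h : (fun t : ℂ => t ^ k • a + t ^ (k + 1) • b) =O[𝓝[≠] 0] fun t => t ^ (k + 2)) :
    a = 0 ∧ b = 0 := by
  have hne : ∀ᶠ t : ℂ in 𝓝[≠] 0, t ≠ 0 := eventually_mem_nhdsWithin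
  have h1 : (fun t : ℂ => a + t • b) =O[𝓝[≠] 0] fun t => t ^ 2 := by
    have := (isBigO_refl (fun t : ℂ => (t ^ k)⁻¹) (𝓝[≠] 0)).smul h
    refine this.congr' ?_ ?_
    · filter_upwards [hne] with t ht
      simp only [smul_add, smul_smul]
      congr 1
      · rw [inv_mul_cancel₀ (pow_ne_zero _ ht), one_smul]
      · rw [pow_succ, ← mul_assoc, inv_mul_cancel₀ (pow_ne_zero _ ht), one_mul]
    · filter_upwards [hne] with t ht
      rw [smul_eq_mul, pow_add, ← mul_assoc, inv_mul_cancel₀ (pow_ne_zero _ ht), one_mul]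
  have ha : a = 0 := by
    have t1 : Tendsto (fun t : ℂ => a + t • b) (𝓝[≠] 0) (𝓝 0) := by
      refine h1.trans_tendsto ?_
      have : Tendsto (fun t : ℂ => t ^ 2) (𝓝 0) (𝓝 (0 ^ 2)) :=
        Continuous.tendsto (by fun_prop) _
      rw [zero_pow two_ne_zero] at this
      exact this.mono_left nhdsWithin_le_nhds
    have t2 : Tendsto (fun t : ℂ => a + t • b) (𝓝[≠] 0) (𝓝 (a + (0 : ℂ) • b)) :=
      Tendsto.mono_left (Continuous.tendsto (by fun_prop) _) nhdsWithin_le_nhds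
    simpa using tendsto_nhds_unique t2 t1
  refine ⟨ha, ?_⟩
  subst ha
  have h2 : (fun _ : ℂ => b) =O[𝓝[≠] (0 : ℂ)] fun t => t := by
    have := (isBigO_refl (fun t : ℂ => t⁻¹) (𝓝[≠] 0)).smul h1
    refine this.congr' ?_ ?_
    · filter_upwards [hne] with t ht
      rw [zero_add, smul_smul, inv_mul_cancel₀ ht, one_smul]
    · filter_upwards [hne] with t ht
      rw [smul_eq_mul, sq, ← mul_assoc, inv_mul_cancel₀ ht, one_mul]
  have t1 : Tendsto (fun _ : ℂ => b) (𝓝[≠] (0 : ℂ)) (𝓝 0) :=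
    h2.trans_tendsto (tendsto_id.mono_left nhdsWithin_le_nhds)
  exact tendsto_nhds_unique tendsto_const_nhds t1

end Growth

/-! ### Homogeneous maps -/

/-- `u` is homogeneous of degree `k`. -/
def HomogeneousOfDegree {V E : Type*} [SMul ℂ V] [SMul ℂ E] (k : ℕ) (u : V → E) : Prop :=
  ∀ (t : ℂ) (y : V), u (t • y) = t ^ k • u y

section Homogeneous

open Asymptotics Filter

variable {V E : Type*} [NormedAddCommGroup V] [NormedSpace ℂ V]
  [NormedAddCommGroup E] [NormedSpace ℂ E]

theorem HomogeneousOfDegree.fderiv_apply {k : ℕ} {u : V → E} (hu : HomogeneousOfDegree k u)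
    (hd : Differentiable ℂ u) (t : ℂ) (y v : V) :
    fderiv ℂ u (t • y) (t • v) = t ^ k • fderiv ℂ u y v := by
  have h1 : HasFDerivAt (fun z => u (t • z))
      ((fderiv ℂ u (t • y)).comp (t • ContinuousLinearMap.id ℂ V)) y :=
    (hd (t • y)).hasFDerivAt.comp y ((hasFDerivAt_id y).const_smul t)
  have h2 : HasFDerivAt (fun z => u (t • z)) (t ^ k • fderiv ℂ u y) y := by
    have : (fun z => u (t • z)) = fun z => t ^ k • u z := funext fun z => hu t z
    rw [this]
    exact (hd y).hasFDerivAt.const_smul _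
  have := congrArg (fun L => L v) (h1.unique h2)
  simpa using this

/-- Euler's identity. -/
theorem HomogeneousOfDegree.fderiv_self {k : ℕ} {u : V → E} (hu : HomogeneousOfDegree k u)
    (hd : Differentiable ℂ u) (y : V) : fderiv ℂ u y y = (k : ℂ) • u y := by
  have h1 : HasDerivAt (fun t : ℂ => u (t • y)) (fderiv ℂ u ((1 : ℂ) • y) ((1 : ℂ) • y)) 1 :=
    (hd _).hasFDerivAt.comp_hasDerivAt (1 : ℂ) ((hasDerivAt_id (1 : ℂ)).smul_const y)
  have h2 : HasDerivAt (fun t : ℂ => u (t • y)) (((k : ℂ) * 1 ^ (k - 1)) • u y) 1 := by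
    have : (fun t : ℂ => u (t • y)) = fun t => t ^ k • u y := funext fun t => hu t y
    rw [this]
    exact (hasDerivAt_pow k (1 : ℂ)).smul_const _
  simpa using h1.unique h2

theorem HomogeneousOfDegree.fderiv_isBigO {k : ℕ} {u : V → E} (hu : HomogeneousOfDegree k u)
    (hd : Differentiable ℂ u) (y : V) :
    (fun t : ℂ => fderiv ℂ u (t • y)) =O[𝓝[≠] 0] fun t => t ^ k * t⁻¹ := by
  refine IsBigO.of_bound ‖fderiv ℂ u y‖ ?_
  filter_upwards [eventually_mem_nhdsWithin] with t ht
  have : fderiv ℂ u (t • y) = (t ^ k * t⁻¹) • fderiv ℂ u y := by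
    ext v
    have := hu.fderiv_apply hd t y (t⁻¹ • v)
    rw [smul_smul, mul_inv_cancel₀ ht, one_smul] at this
    simp [this, smul_smul]
  rw [this, norm_smul, mul_comm]

/-- The leading order of a linear differential relation `Du · X = B u` at a zero of `X`: if
`u = u₀ + u₁ + ⋯`, `X = S + X₂ + ⋯` and `B = A + B₁ + ⋯` are the expansions into homogeneous
parts, the relation may be read off in the two lowest degrees. -/
theorem leading_relations {k : ℕ} {u u₀ u₁ : V → E} {X X₂ : V → V} {S : V →L[ℂ] V}
    {B B₁ : V → E →L[ℂ] E} {A : E →L[ℂ] E}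
    (h₀ : HomogeneousOfDegree k u₀) (d₀ : Differentiable ℂ u₀)
    (h₁ : HomogeneousOfDegree (k + 1) u₁) (d₁ : Differentiable ℂ u₁)
    (hX₂ : HomogeneousOfDegree 2 X₂) (hB₁ : HomogeneousOfDegree 1 B₁)
    (hu : (fun y => u y - (u₀ y + u₁ y)) =O[𝓝 0] fun y => ‖y‖ ^ (k + 2))
    (hDu : (fun y => fderiv ℂ u y - (fderiv ℂ u₀ y + fderiv ℂ u₁ y)) =O[𝓝 0]
      fun y => ‖y‖ ^ (k + 1))
    (hX : (fun y => X y - (S y + X₂ y)) =O[𝓝 0] fun y => ‖y‖ ^ 3)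
    (hB : (fun y => B y - (A + B₁ y)) =O[𝓝 0] fun y => ‖y‖ ^ 2)
    (hrel : ∀ᶠ y in 𝓝 (0 : V), fderiv ℂ u y (X y) = B y (u y)) (y : V) :
    fderiv ℂ u₀ y (S y) = A (u₀ y) ∧
      fderiv ℂ u₀ y (X₂ y) + fderiv ℂ u₁ y (S y) = A (u₁ y) + B₁ y (u₀ y) := by
  have htend : Tendsto (fun t : ℂ => t • y) (𝓝[≠] 0) (𝓝 0) := by
    have : Tendsto (fun t : ℂ => t • y) (𝓝 0) (𝓝 ((0 : ℂ) • y)) :=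
      Continuous.tendsto (by fun_prop) _
    rw [zero_smul] at this
    exact this.mono_left nhdsWithin_le_nhds
  have hpow : ∀ n : ℕ, (fun t : ℂ => ‖t • y‖ ^ n) =O[𝓝[≠] 0] fun t => t ^ n := fun n => by
    refine IsBigO.of_bound (‖y‖ ^ n) (Eventually.of_forall fun t => ?_)
    rw [Real.norm_of_nonneg (by positivity), norm_smul, norm_pow, mul_pow, mul_comm]
  have hu' := (hu.comp_tendsto htend).trans (hpow _)
  have hDu' := (hDu.comp_tendsto htend).trans (hpow _)
  have hX' := (hX.comp_tendsto htend).trans (hpow _)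
  have hB' := (hB.comp_tendsto htend).trans (hpow _)
  have hrel' := htend.eventually hrel
  simp only [Function.comp_def] at hu' hDu' hX' hB'
  have hle : ∀ {m n : ℕ}, m ≤ n → (fun t : ℂ => t ^ n) =O[𝓝[≠] (0 : ℂ)] fun t => t ^ m := by
    intro m n hmn
    refine IsBigO.of_bound 1 ?_
    filter_upwards [nhdsWithin_le_nhds (Metric.ball_mem_nhds (0 : ℂ) one_pos)] with t ht
    rw [one_mul, norm_pow, norm_pow]
    exact pow_le_pow_of_le_one (norm_nonneg _) (mem_ball_zero_iff.1 ht).le hmn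
  have hsmul : ∀ {m n : ℕ} (w : V), m ≤ n →
      (fun t : ℂ => t ^ n • w) =O[𝓝[≠] (0 : ℂ)] fun t => t ^ m := fun {m n} w hmn =>
    IsBigO.trans (IsBigO.of_bound ‖w‖ (Eventually.of_forall fun t => by
      rw [norm_smul, mul_comm])) (hle hmn)
  have hsmul' : ∀ {m n : ℕ} (w : E), m ≤ n →
      (fun t : ℂ => t ^ n • w) =O[𝓝[≠] (0 : ℂ)] fun t => t ^ m := fun {m n} w hmn =>
    IsBigO.trans (IsBigO.of_bound ‖w‖ (Eventually.of_forall fun t => by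
      rw [norm_smul, mul_comm])) (hle hmn)
  -- orders of the four factors
  have oX : (fun t : ℂ => X (t • y)) =O[𝓝[≠] 0] fun t => t ^ 1 := by
    have := ((hX'.trans (hle (m := 1) (by norm_num))).add
      (hsmul (m := 1) (n := 1) (S y) le_rfl)).add (hsmul (m := 1) (n := 2) (X₂ y) (by norm_num))
    refine this.congr_left fun t => ?_
    rw [hX₂ t y, map_smul, pow_one]
    abel
  have ou : (fun t : ℂ => u (t • y)) =O[𝓝[≠] 0] fun t => t ^ k := by
    have := ((hu'.trans (hle (m := k) (by lia))).add
      (hsmul' (m := k) (n := k) (u₀ y) le_rfl)).add (hsmul' (m := k) (n := k + 1) (u₁ y) (by lia))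
    refine this.congr_left fun t => ?_
    rw [h₀ t y, h₁ t y]
    abel
  have oD : (fun t : ℂ => fderiv ℂ u₀ (t • y) + fderiv ℂ u₁ (t • y)) =O[𝓝[≠] 0]
      fun t => t ^ k * t⁻¹ := by
    refine (h₀.fderiv_isBigO d₀ y).add ((h₁.fderiv_isBigO d₁ y).trans ?_)
    exact (hle (Nat.le_succ k)).mul (isBigO_refl _ _)
  have oB : (fun t : ℂ => A + B₁ (t • y)) =O[𝓝[≠] 0] fun _ => (1 : ℂ) := by
    have : Tendsto (fun t : ℂ => A + t • B₁ y) (𝓝[≠] 0) (𝓝 (A + (0 : ℂ) • B₁ y)) :=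
      Tendsto.mono_left (Continuous.tendsto (by fun_prop) _) nhdsWithin_le_nhds
    refine IsBigO.congr_left (this.isBigO_one ℂ) fun t => ?_
    rw [hB₁ t y, pow_one]
  have e1 := (isBigO_clm_apply hDu' oX).congr_right fun t => (pow_add t (k + 1) 1).symm
  have e2 : (fun t : ℂ => (fderiv ℂ u₀ (t • y) + fderiv ℂ u₁ (t • y))
      (X (t • y) - (S (t • y) + X₂ (t • y)))) =O[𝓝[≠] 0] fun t => t ^ (k + 2) := by
    refine (isBigO_clm_apply oD hX').congr' EventuallyEq.rfl ?_
    filter_upwards [eventually_mem_nhdsWithin] with t (ht : t ≠ 0)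
    field_simp
    ring
  have e3 := (isBigO_clm_apply hB' ou).congr_right fun t =>
    show t ^ 2 * t ^ k = t ^ (k + 2) by ring
  have e4 := (isBigO_clm_apply oB hu').congr_right fun t => one_mul _
  have main : (fun t : ℂ =>
      t ^ k • (fderiv ℂ u₀ y (S y) - A (u₀ y)) +
      t ^ (k + 1) • (fderiv ℂ u₀ y (X₂ y) + fderiv ℂ u₁ y (S y) - (A (u₁ y) + B₁ y (u₀ y))))
      =O[𝓝[≠] 0] fun t => t ^ (k + 2) := by
    have e5 := hsmul' (m := k + 2) (n := k + 2)
      (B₁ y (u₁ y) - fderiv ℂ u₁ y (X₂ y)) le_rfl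
    refine ((((e3.add e4).sub e1).sub e2).add e5).congr' ?_ EventuallyEq.rfl
    filter_upwards [hrel'] with t ht
    have q1 : fderiv ℂ u₀ (t • y) (S (t • y)) = t ^ k • fderiv ℂ u₀ y (S y) := by
      rw [map_smul, h₀.fderiv_apply d₀]
    have q2 : fderiv ℂ u₁ (t • y) (S (t • y)) = t ^ (k + 1) • fderiv ℂ u₁ y (S y) := by
      rw [map_smul, h₁.fderiv_apply d₁]
    have q3 : fderiv ℂ u₀ (t • y) (X₂ (t • y)) = t ^ (k + 1) • fderiv ℂ u₀ y (X₂ y) := by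
      rw [hX₂, sq, mul_smul, h₀.fderiv_apply d₀, map_smul, smul_smul, pow_succ]
    have q4 : fderiv ℂ u₁ (t • y) (X₂ (t • y)) = t ^ (k + 2) • fderiv ℂ u₁ y (X₂ y) := by
      rw [hX₂, sq, mul_smul, h₁.fderiv_apply d₁, map_smul, smul_smul, ← pow_succ]
    simp only [add_apply, sub_apply, map_add, map_sub,
      q1, q2, q3, q4, ht, h₀ t y, h₁ t y, hB₁ t y, map_smul A, map_smul (B₁ y), smul_apply,
      smul_sub, smul_add]
    module
  have := eq_zero_of_smul_add_smul_isBigO main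
  exact ⟨sub_eq_zero.1 this.1, sub_eq_zero.1 this.2⟩

end Homogeneous

/-! ### Holomorphic maps vanishing at the real points -/

/-- An entire map that vanishes on `ℝⁿ` vanishes on `ℂⁿ`. -/
theorem eq_zero_of_forall_real {n : ℕ} {E : Type*} [NormedAddCommGroup E] [NormedSpace ℂ E]
    [CompleteSpace E] {g : (Fin n → ℂ) → E} (hg : Differentiable ℂ g)
    (h : ∀ x : Fin n → ℝ, g (fun i => (x i : ℂ)) = 0) (y : Fin n → ℂ) : g y = 0 := by
  -- the line through `Re y` with direction `Im y` passes through `y` at the parameter `i`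
  let φ : ℂ → E := fun z => g fun i => ((y i).re : ℂ) + z * ((y i).im : ℂ)
  have hφ : Differentiable ℂ φ := hg.comp (by fun_prop)
  have han : AnalyticOnNhd ℂ φ Set.univ := hφ.differentiableOn.analyticOnNhd isOpen_univ
  have hreal : Filter.Tendsto (fun x : ℝ => (x : ℂ)) (𝓝[≠] 0) (𝓝[≠] 0) := by
    refine tendsto_nhdsWithin_iff.2 ⟨?_, ?_⟩
    · exact (Complex.continuous_ofReal.tendsto' 0 0 Complex.ofReal_zero).mono_left
        nhdsWithin_le_nhds
    · filter_upwards [eventually_mem_nhdsWithin] with x hx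
      simpa using hx
  have hfr : ∃ᶠ z in 𝓝[≠] (0 : ℂ), φ z = 0 := by
    refine hreal.frequently (Filter.Eventually.frequently (Filter.Eventually.of_forall ?_))
    intro x
    have := h fun i => (y i).re + x * (y i).im
    push_cast at this
    exact this
  have := han.eqOn_zero_of_preconnected_of_frequently_eq_zero isPreconnected_univ
    (Set.mem_univ 0) hfr (Set.mem_univ Complex.I)
  have hy : (fun i => ((y i).re : ℂ) + Complex.I * ((y i).im : ℂ)) = y := by
    funext i
    rw [mul_comm]
    exact Complex.re_add_im (y i)
  simpa [φ, hy] using this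

/-! ### Averaging over a periodic linear flow -/

section Averaging

variable {V E : Type*} [NormedAddCommGroup V] [NormedSpace ℂ V]
  [NormedAddCommGroup E] [NormedSpace ℂ E] {S : V →L[ℂ] V} {A : E →L[ℂ] E}
  {φ : ℂ → V →L[ℂ] V} {ψ : ℂ → E →L[ℂ] E}

/-- Along the flow `φ` of `S`, and with `ψ` the inverse of the flow of `A`, the transported map
`ψ_t ∘ u ∘ φ_t` changes at the rate given by `Du · S - A u`. -/
theorem hasDerivAt_transport (hφ : ∀ t, HasDerivAt φ (S.comp (φ t)) t)
    (hψ : ∀ t, HasDerivAt ψ (-(ψ t).comp A) t) {u : V → E} (hu : Differentiable ℂ u)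
    (y : V) (t : ℂ) :
    HasDerivAt (fun t => ψ t (u (φ t y)))
      (ψ t (fderiv ℂ u (φ t y) (S (φ t y)) - A (u (φ t y)))) t := by
  have h1 : HasDerivAt (fun t => φ t y) (S (φ t y)) t := by
    simpa using (hφ t).clm_apply (hasDerivAt_const t y)
  have h2 : HasDerivAt (fun t => u (φ t y)) (fderiv ℂ u (φ t y) (S (φ t y))) t :=
    (hu _).hasFDerivAt.comp_hasDerivAt t h1
  have h3 := (hψ t).clm_apply h2
  refine h3.congr_deriv ?_
  simp only [neg_apply, ContinuousLinearMap.comp_apply, map_sub]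
  abel

theorem transport_eq_self (hφ : ∀ t, HasDerivAt φ (S.comp (φ t)) t)
    (hψ : ∀ t, HasDerivAt ψ (-(ψ t).comp A) t) (hφ0 : φ 0 = 1) (hψ0 : ψ 0 = 1)
    {u : V → E} (hu : Differentiable ℂ u) (h : ∀ y, fderiv ℂ u y (S y) = A (u y))
    (t : ℂ) (y : V) : ψ t (u (φ t y)) = u y := by
  have hd : ∀ s, HasDerivAt (fun s => ψ s (u (φ s y))) 0 s := fun s =>
    (hasDerivAt_transport hφ hψ hu y s).congr_deriv (by rw [h, sub_self, map_zero])
  have := is_const_of_deriv_eq_zero (fun s => (hd s).differentiableAt) (fun s => (hd s).deriv) t 0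
  simpa [hφ0, hψ0] using this

/-- The kernel and the range of a linear differential operator with periodic flow meet only in
`0`: an invariant map `w = Du · S - A u` vanishes, because transport over one period adds to `u`
a nonzero multiple of `w`. -/
theorem eq_zero_of_transport_eq_self (hφ : ∀ t, HasDerivAt φ (S.comp (φ t)) t)
    (hψ : ∀ t, HasDerivAt ψ (-(ψ t).comp A) t) (hφ0 : φ 0 = 1) (hψ0 : ψ 0 = 1)
    {T : ℂ} (hT : T ≠ 0) (hφT : φ T = 1) (hψT : ψ T = 1) {u w : V → E}
    (hu : Differentiable ℂ u) (hw : ∀ t y, ψ t (w (φ t y)) = w y)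
    (h : ∀ y, fderiv ℂ u y (S y) - A (u y) = w y) (y : V) : w y = 0 := by
  have hd : ∀ s, HasDerivAt (fun s => ψ s (u (φ s y)) - s • w y) 0 s := fun s => by
    have := (hasDerivAt_transport hφ hψ hu y s).sub ((hasDerivAt_id s).smul_const (w y))
    refine this.congr_deriv ?_
    rw [h, hw, one_smul, sub_self]
  have := is_const_of_deriv_eq_zero (fun s => (hd s).differentiableAt) (fun s => (hd s).deriv) T 0
  simp only [hφT, hψT, hφ0, hψ0, one_apply_eq_self, zero_smul, sub_zero] at this
  have h2 : T • w y = 0 := by simpa using this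
  exact (smul_eq_zero.1 h2).resolve_left hT

end Averaging

/-! ### Leading homogeneous parts of analytic solutions -/

/-- The homogeneous part of degree `k` of a power series at `0`. -/
def homPart {V E : Type*} [NormedAddCommGroup V] [NormedSpace ℂ V]
    [NormedAddCommGroup E] [NormedSpace ℂ E] (p : FormalMultilinearSeries ℂ V E) (k : ℕ)
    (y : V) : E := p k fun _ => y

section HomPart

open Asymptotics Filter

variable {V E : Type*} [NormedAddCommGroup V] [NormedSpace ℂ V]
  [NormedAddCommGroup E] [NormedSpace ℂ E]

theorem homPart_homogeneous (p : FormalMultilinearSeries ℂ V E) (k : ℕ) :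
    HomogeneousOfDegree k (homPart p k) := fun t y => by
  simpa [homPart] using (p k).map_smul_univ (fun _ => t) (fun _ => y)

theorem homPart_contDiff (p : FormalMultilinearSeries ℂ V E) (k : ℕ) {n : WithTop ℕ∞} :
    ContDiff ℂ n (homPart p k) :=
  (p k).contDiff.comp (contDiff_pi.2 fun _ => contDiff_id)

theorem homPart_differentiable (p : FormalMultilinearSeries ℂ V E) (k : ℕ) :
    Differentiable ℂ (homPart p k) :=
  (homPart_contDiff p k (n := 1)).differentiable one_ne_zero

theorem HasFPowerSeriesAt.exists_leading_homPart {u : V → E} {p : FormalMultilinearSeries ℂ V E}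
    (hp : HasFPowerSeriesAt u p 0) (hu : ¬ ∀ᶠ y in 𝓝 0, u y = 0) :
    ∃ k, (∃ y, homPart p k y ≠ 0) ∧ ∀ j < k, ∀ y, homPart p j y = 0 := by
  classical
  have hex : ∃ k, ∃ y, homPart p k y ≠ 0 := by
    by_contra! hcon
    refine hu ?_
    filter_upwards [hp.eventually_hasSum] with y hy
    have : (fun n => p n fun _ : Fin n => y) = fun _ => 0 := funext fun n => hcon n y
    rw [this, zero_add] at hy
    exact hy.unique hasSum_zero
  refine ⟨Nat.find hex, Nat.find_spec hex, fun j hj y => ?_⟩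
  by_contra hne
  exact Nat.find_min hex hj ⟨y, hne⟩

theorem HasFPowerSeriesAt.isBigO_sub_homPart {u : V → E} {p : FormalMultilinearSeries ℂ V E}
    (hp : HasFPowerSeriesAt u p 0) {k : ℕ} (hk : ∀ j < k, ∀ y, homPart p j y = 0) :
    (fun y => u y - (homPart p k y + homPart p (k + 1) y)) =O[𝓝 0] fun y => ‖y‖ ^ (k + 2) := by
  refine (hp.isBigO_sub_partialSum_pow (k + 2)).congr_left fun y => ?_
  have : p.partialSum (k + 2) y = ∑ j ∈ Finset.range (k + 2), homPart p j y := rfl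
  rw [zero_add, this, Finset.sum_range_succ, Finset.sum_range_succ,
    Finset.sum_eq_zero fun j hj => hk j (Finset.mem_range.1 hj) y, zero_add]

variable [CompleteSpace E]

/-- The lowest homogeneous part `u_k` of an analytic solution of `Du · X = B u` satisfies the
relation for the linear parts `S`, `A` and also the one for the next parts `X₂`, `B₁`, provided
these are invariant under the periodic flow of the linear parts: the defect
`Du_k · X₂ - B₁ u_k` is invariant and of the form `A v - Dv · S`. -/
theorem HasFPowerSeriesAt.leading_homPart_relations {k : ℕ} {u : V → E}
    {p : FormalMultilinearSeries ℂ V E} {X X₂ : V → V} {S : V →L[ℂ] V} {B B₁ : V → E →L[ℂ] E}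
    {A : E →L[ℂ] E} {φ : ℂ → V →L[ℂ] V} {ψ : ℂ → E →L[ℂ] E}
    (hp : HasFPowerSeriesAt u p 0) (hk : ∀ j < k, ∀ y, homPart p j y = 0)
    (hX₂ : HomogeneousOfDegree 2 X₂) (hB₁ : HomogeneousOfDegree 1 B₁)
    (hX : (fun y => X y - (S y + X₂ y)) =O[𝓝 0] fun y => ‖y‖ ^ 3)
    (hB : (fun y => B y - (A + B₁ y)) =O[𝓝 0] fun y => ‖y‖ ^ 2)
    (hrel : ∀ᶠ y in 𝓝 (0 : V), fderiv ℂ u y (X y) = B y (u y))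
    (hφ : ∀ t, HasDerivAt φ (S.comp (φ t)) t) (hψ : ∀ t, HasDerivAt ψ (-(ψ t).comp A) t)
    (hφ0 : φ 0 = 1) (hψ0 : ψ 0 = 1)
    {T : ℂ} (hT : T ≠ 0) (hφT : φ T = 1) (hψT : ψ T = 1)
    (hXφ : ∀ t y, X₂ (φ t y) = φ t (X₂ y))
    (hBψ : ∀ t y e, ψ t (B₁ (φ t y) e) = B₁ y (ψ t e)) :
    (∀ y, fderiv ℂ (homPart p k) y (S y) = A (homPart p k y)) ∧
      ∀ y, fderiv ℂ (homPart p k) y (X₂ y) = B₁ y (homPart p k y) := by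
  have hO := hp.isBigO_sub_homPart hk
  have d₀ := homPart_differentiable p k
  have d₁ := homPart_differentiable p (k + 1)
  have hdu : ∀ᶠ y in 𝓝 (0 : V), DifferentiableAt ℂ u y :=
    hp.analyticAt.eventually_analyticAt.mono fun y hy => hy.differentiableAt
  have hDO : (fun y => fderiv ℂ u y - (fderiv ℂ (homPart p k) y + fderiv ℂ (homPart p (k + 1)) y))
      =O[𝓝 0] fun y => ‖y‖ ^ (k + 1) := by
    refine (isBigO_fderiv_of_isBigO_norm_pow ?_ hO).congr' ?_ EventuallyEq.rfl
    · exact hdu.mono fun y hy => hy.sub ((d₀ y).add (d₁ y))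
    · filter_upwards [hdu] with y hy
      exact (hy.hasFDerivAt.fun_sub ((d₀ y).hasFDerivAt.fun_add (d₁ y).hasFDerivAt)).fderiv
  have main := leading_relations (homPart_homogeneous p k) d₀ (homPart_homogeneous p (k + 1)) d₁
    hX₂ hB₁ hO hDO hX hB hrel
  have hS := fun y => (main y).1
  refine ⟨hS, fun y => ?_⟩
  have hinv := transport_eq_self hφ hψ hφ0 hψ0 d₀ hS
  have hDinv : ∀ t y v, ψ t (fderiv ℂ (homPart p k) (φ t y) (φ t v)) =
      fderiv ℂ (homPart p k) y v := by
    intro t y v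
    have h1 : HasFDerivAt (fun y => ψ t (homPart p k (φ t y)))
        ((ψ t).comp ((fderiv ℂ (homPart p k) (φ t y)).comp (φ t))) y :=
      (ψ t).hasFDerivAt.comp y ((d₀ _).hasFDerivAt.comp y (φ t).hasFDerivAt)
    have h2 : (fun y => ψ t (homPart p k (φ t y))) = homPart p k := funext (hinv t)
    rw [h2] at h1
    rw [h1.fderiv]
    rfl
  let w : V → E := fun y => B₁ y (homPart p k y) - fderiv ℂ (homPart p k) y (X₂ y)
  have hw : ∀ t y, ψ t (w (φ t y)) = w y := by
    intro t y
    simp only [w]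
    rw [map_sub, hBψ, hinv, hXφ, hDinv]
  have hwu : ∀ y, fderiv ℂ (homPart p (k + 1)) y (S y) - A (homPart p (k + 1) y) = w y := by
    intro y
    have := (main y).2
    simp only [w]
    rw [sub_eq_sub_iff_add_eq_add, add_comm, this, add_comm]
  have := eq_zero_of_transport_eq_self hφ hψ hφ0 hψ0 hT hφT hψT d₁ hw hwu y
  exact (sub_eq_zero.1 this).symm

end HomPart

/-! ### The planar system -/

/-- A homogeneous entire function that is not identically zero is nonzero almost everywhere: it is
so along every line in a direction in which it does not vanish. -/
theorem HomogeneousOfDegree.ae_ne_zero {n k : ℕ} {D : (Fin n → ℂ) → ℂ}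
    (hD : HomogeneousOfDegree k D) (hd : Differentiable ℂ D) {v : Fin n → ℂ} (hv : D v ≠ 0) :
    ∀ᵐ y ∂(volume : Measure (Fin n → ℂ)), D y ≠ 0 := by
  refine ae_mem_of_ae_add_linearMap_mem (𝕜 := ℂ) (s := {y | D y ≠ 0})
    (LinearMap.toSpanSingleton ℂ (Fin n → ℂ) v) volume volume ?_ ?_
  · exact (isOpen_ne_fun hd.continuous continuous_const).measurableSet
  intro y
  let h : ℂ → ℂ := fun z => D (y + z • v)
  have hh : Differentiable ℂ h := hd.comp (by fun_prop)
  -- for large parameters the line is close to the direction `v`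
  obtain ⟨z₀, hz₀⟩ : ∃ z, h z ≠ 0 := by
    by_contra! hcon
    have h1 : ∀ s : ℂ, s ≠ 0 → D (v + s • y) = 0 := by
      intro s hs
      have h2 := hD s (y + s⁻¹ • v)
      rw [smul_add, smul_smul, mul_inv_cancel₀ hs, one_smul, add_comm] at h2
      rw [h2, show D (y + s⁻¹ • v) = 0 from hcon s⁻¹, smul_zero]
    have t1 : Filter.Tendsto (fun s : ℂ => D (v + s • y)) (𝓝[≠] 0) (𝓝 (D (v + (0 : ℂ) • y))) :=
      ((hd.continuous.comp (by fun_prop : Continuous fun s : ℂ => v + s • y)).tendsto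
        0).mono_left nhdsWithin_le_nhds
    have t2 : Filter.Tendsto (fun s : ℂ => D (v + s • y)) (𝓝[≠] 0) (𝓝 0) := by
      refine tendsto_const_nhds.congr' ?_
      filter_upwards [eventually_mem_nhdsWithin] with s hs using (h1 s hs).symm
    exact hv (by simpa using tendsto_nhds_unique t1 t2)
  have han : AnalyticOnNhd ℂ h Set.univ := hh.differentiableOn.analyticOnNhd isOpen_univ
  have hcd := han.preimage_zero_mem_codiscrete hz₀
  have hcount : (h ⁻¹' {0}).Countable :=
    (HereditarilyLindelofSpace.isLindelof _).countable_of_isDiscrete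
      (by simpa using isDiscrete_of_codiscreteWithin (s := h ⁻¹' {0}) (U := Set.univ) hcd)
  have := hcount.measure_zero (volume : Measure ℂ)
  rw [ae_iff]
  refine measure_mono_null ?_ this
  intro z hz
  simpa [h] using hz

/-- The `i`-th coordinate as a continuous linear form on `ℂⁿ`. -/
noncomputable abbrev coordForm {n : ℕ} (i : Fin n) : (Fin n → ℂ) →L[ℂ] ℂ :=
  ContinuousLinearMap.proj i

theorem hasFDerivAt_coord {n : ℕ} (i : Fin n) (z : Fin n → ℂ) :
    HasFDerivAt (fun z : Fin n → ℂ => z i) (coordForm i) z :=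
  (coordForm i).hasFDerivAt

theorem fderiv_truncatedPlanarField (α₁ α₃ α₄ : ℝ) (z w : Fin 2 → ℂ) :
    fderiv ℂ (truncatedPlanarField α₁ α₃ α₄) z w =
      ![α₁ * (w 0 * z 1 + z 0 * w 1), 2 * (α₃ * z 0 * w 0 + α₄ * z 1 * w 1)] := by
  have h : HasFDerivAt (truncatedPlanarField α₁ α₃ α₄) (ContinuousLinearMap.pi
      ![(α₁ : ℂ) • (z 1 • coordForm 0 + z 0 • coordForm 1),
        (2 * α₃ * z 0 : ℂ) • coordForm 0 +
          (2 * α₄ * z 1 : ℂ) • coordForm 1]) z := by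
    refine hasFDerivAt_pi'' fun i => ?_
    fin_cases i
    · refine (((hasFDerivAt_coord 0 z).const_mul (α₁ : ℂ)).mul
        (hasFDerivAt_coord 1 z)).congr_fderiv ?_
      ext v
      simp
      ring
    · refine ((((hasFDerivAt_coord 0 z).pow 2).const_mul (α₃ : ℂ)).add
        (((hasFDerivAt_coord 1 z).pow 2).const_mul (α₄ : ℂ))).congr_fderiv ?_
      ext v
      simp
      ring
  rw [h.fderiv]
  ext i
  fin_cases i
  · simp
    ring
  · simp
    ring

theorem analyticAt_coord {n : ℕ} (i : Fin n) (z : Fin n → ℂ) :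
    AnalyticAt ℂ (fun z : Fin n → ℂ => z i) z :=
  (coordForm i).analyticAt z

theorem analyticAt_truncatedPlanarField (α₁ α₃ α₄ : ℝ) (z : Fin 2 → ℂ) :
    AnalyticAt ℂ (truncatedPlanarField α₁ α₃ α₄) z := by
  refine AnalyticAt.pi fun i => ?_
  fin_cases i
  · exact (analyticAt_const.mul (analyticAt_coord 0 z)).mul (analyticAt_coord 1 z)
  · exact (analyticAt_const.mul ((analyticAt_coord 0 z).pow 2)).add
      (analyticAt_const.mul ((analyticAt_coord 1 z).pow 2))

theorem truncatedPlanarField_homogeneous (α₁ α₃ α₄ : ℝ) :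
    HomogeneousOfDegree 2 (truncatedPlanarField α₁ α₃ α₄) := fun t y => by
  ext i
  fin_cases i
  · simp [truncatedPlanarField]
    ring
  · simp [truncatedPlanarField]
    ring

theorem ae_truncatedPlanarField_ne_zero {α₁ α₃ α₄ : ℝ} (hα : ¬ (α₁ = 0 ∧ α₃ = 0 ∧ α₄ = 0)) :
    ∀ᵐ y ∂(volume : Measure (Fin 2 → ℂ)), truncatedPlanarField α₁ α₃ α₄ y ≠ 0 := by
  have hd : Differentiable ℂ (truncatedPlanarField α₁ α₃ α₄) := fun z =>
    (analyticAt_truncatedPlanarField α₁ α₃ α₄ z).differentiableAt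
  have key : ∀ (i : Fin 2) (v : Fin 2 → ℂ), truncatedPlanarField α₁ α₃ α₄ v i ≠ 0 →
      ∀ᵐ y ∂(volume : Measure (Fin 2 → ℂ)), truncatedPlanarField α₁ α₃ α₄ y ≠ 0 := by
    intro i v hv
    have hh : HomogeneousOfDegree 2 fun z => truncatedPlanarField α₁ α₃ α₄ z i := fun t y => by
      simp [truncatedPlanarField_homogeneous α₁ α₃ α₄ t y]
    have hdi : Differentiable ℂ fun z => truncatedPlanarField α₁ α₃ α₄ z i :=
      differentiable_pi.1 hd i
    filter_upwards [hh.ae_ne_zero hdi hv] with y hy h0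
    exact hy (by rw [h0]; rfl)
  by_cases h1 : α₁ = 0
  · by_cases h3 : α₃ = 0
    · have h4 : α₄ ≠ 0 := fun h4 => hα ⟨h1, h3, h4⟩
      exact key 1 ![0, 1] (by simpa [truncatedPlanarField] using h4)
    · exact key 1 ![1, 0] (by simpa [truncatedPlanarField] using h3)
  · exact key 0 ![1, 1] (by simpa [truncatedPlanarField] using h1)

/-- A nonconstant homogeneous first integral makes the planar system integrable, with one vector
field and one integral. -/
theorem planar_integrable_of_firstIntegral {α₁ α₃ α₄ : ℝ}
    (hα : ¬ (α₁ = 0 ∧ α₃ = 0 ∧ α₄ = 0)) {k : ℕ} (hk : k ≠ 0) {H : (Fin 2 → ℂ) → ℂ}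
    (hA : ∀ z, AnalyticAt ℂ H z) (hH : HomogeneousOfDegree k H) {v : Fin 2 → ℂ} (hv : H v ≠ 0)
    (hint : ∀ z, fderiv ℂ H z (truncatedPlanarField α₁ α₃ α₄ z) = 0) :
    AnalyticallyIntegrableNearZero 2 (truncatedPlanarField α₁ α₃ α₄) := by
  have hd : Differentiable ℂ H := fun z => (hA z).differentiableAt
  refine ⟨Set.univ, 0, 1, fun _ => truncatedPlanarField α₁ α₃ α₄, fun _ => H, isOpen_univ,
    Set.mem_univ 0, rfl, fun _ z _ => analyticAt_truncatedPlanarField α₁ α₃ α₄ z,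
    fun _ z _ => hA z, fun z _ => rfl, ?_, fun _ _ z _ => by simp, ?_, fun _ _ z _ => hint z⟩
  · rw [Measure.restrict_univ]
    filter_upwards [ae_truncatedPlanarField_ne_zero hα] with z hz
    exact LinearIndependent.of_subsingleton (ι := Fin 1) 0 hz
  · rw [Measure.restrict_univ]
    filter_upwards [hH.ae_ne_zero hd hv] with z hz
    refine LinearIndependent.of_subsingleton 0 fun h0 => ?_
    -- Euler's identity: `dH` cannot vanish where `H` does not
    have := hH.fderiv_self hd z
    rw [h0, zero_apply] at this
    rcases smul_eq_zero.1 this.symm with h | h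
    · exact hk (by exact_mod_cast h)
    · exact hz h

/-- A homogeneous vector field that commutes with the planar field and is somewhere independent
of it makes the planar system integrable, with two vector fields and no integral. -/
theorem planar_integrable_of_commuting {α₁ α₃ α₄ : ℝ} {k : ℕ}
    {g : (Fin 2 → ℂ) → (Fin 2 → ℂ)} (hA : ∀ z, AnalyticAt ℂ g z) (hg : HomogeneousOfDegree k g)
    {v : Fin 2 → ℂ}
    (hv : truncatedPlanarField α₁ α₃ α₄ v 0 * g v 1 - truncatedPlanarField α₁ α₃ α₄ v 1 * g v 0
      ≠ 0)
    (hcomm : ∀ z, fderiv ℂ g z (truncatedPlanarField α₁ α₃ α₄ z) =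
      fderiv ℂ (truncatedPlanarField α₁ α₃ α₄) z (g z)) :
    AnalyticallyIntegrableNearZero 2 (truncatedPlanarField α₁ α₃ α₄) := by
  set P := truncatedPlanarField α₁ α₃ α₄ with hP
  have hdg : Differentiable ℂ g := fun z => (hA z).differentiableAt
  have hdP : Differentiable ℂ P := fun z =>
    (analyticAt_truncatedPlanarField α₁ α₃ α₄ z).differentiableAt
  have hdet : HomogeneousOfDegree (2 + k) fun z => P z 0 * g z 1 - P z 1 * g z 0 := fun t y => by
    simp only [hP, truncatedPlanarField_homogeneous α₁ α₃ α₄ t y, hg t y, Pi.smul_apply,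
      smul_eq_mul]
    ring
  have hddet : Differentiable ℂ fun z => P z 0 * g z 1 - P z 1 * g z 0 :=
    ((differentiable_pi.1 hdP 0).mul (differentiable_pi.1 hdg 1)).sub
      ((differentiable_pi.1 hdP 1).mul (differentiable_pi.1 hdg 0))
  refine ⟨Set.univ, 1, 0, ![P, g], Fin.elim0, isOpen_univ, Set.mem_univ 0, rfl, ?_,
    fun k => k.elim0, fun z _ => rfl, ?_, ?_, ?_, fun _ k => k.elim0⟩
  · intro j z _
    fin_cases j
    · exact analyticAt_truncatedPlanarField α₁ α₃ α₄ z
    · exact hA z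
  · rw [Measure.restrict_univ]
    filter_upwards [hdet.ae_ne_zero hddet hv] with z hz
    have : (fun j : Fin (1 + 1) => (![P, g] : Fin 2 → _) j z) = ![P z, g z] := by
      ext j
      fin_cases j <;> rfl
    rw [this, LinearIndependent.pair_iff]
    intro s t hst
    have h0 := congrFun hst 0
    have h1 := congrFun hst 1
    simp only [Pi.add_apply, Pi.smul_apply, smul_eq_mul, Pi.zero_apply] at h0 h1
    have hs : s * (P z 0 * g z 1 - P z 1 * g z 0) = 0 := by
      linear_combination g z 1 * h0 - g z 0 * h1
    have ht : t * (P z 0 * g z 1 - P z 1 * g z 0) = 0 := by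
      linear_combination P z 0 * h1 - P z 1 * h0
    exact ⟨(mul_eq_zero.1 hs).resolve_right hz, (mul_eq_zero.1 ht).resolve_right hz⟩
  · intro i j z _
    have h : VectorField.lieBracket ℂ P g z = 0 := by
      rw [VectorField.lieBracket_eq]
      exact sub_eq_zero.2 (hcomm z)
    fin_cases i <;> fin_cases j
    · simp
    · exact h
    · show VectorField.lieBracket ℂ g P z = 0
      rw [VectorField.lieBracket_swap, h, neg_zero]
    · simp
  · exact Filter.Eventually.of_forall fun z => linearIndependent_empty_type

/-- The degenerate coefficients, for which an integral or a commuting field is explicit. -/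
theorem planar_integrable_of_coeff_eq_zero {α₁ α₃ α₄ : ℝ}
    (hα : ¬ (α₁ = 0 ∧ α₃ = 0 ∧ α₄ = 0)) (h : α₁ = 0 ∨ α₃ = 0 ∨ α₄ = 0) :
    AnalyticallyIntegrableNearZero 2 (truncatedPlanarField α₁ α₃ α₄) := by
  by_cases h1 : α₁ = 0
  · refine planar_integrable_of_firstIntegral hα one_ne_zero (H := fun z => z 0)
      (analyticAt_coord 0) (fun t y => by simp) (v := ![1, 0]) (by simp) fun z => ?_
    rw [(hasFDerivAt_coord 0 z).fderiv]
    simp [truncatedPlanarField, h1]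
  by_cases h4 : α₄ = 0
  · have hder : ∀ z : Fin 2 → ℂ, HasFDerivAt
        (fun z : Fin 2 → ℂ => (α₃ : ℂ) * z 0 ^ 2 - (α₁ : ℂ) * z 1 ^ 2) _ z := fun z =>
      (((hasFDerivAt_coord 0 z).pow 2).const_mul (α₃ : ℂ)).fun_sub
        (((hasFDerivAt_coord 1 z).pow 2).const_mul (α₁ : ℂ))
    refine planar_integrable_of_firstIntegral hα two_ne_zero
      (H := fun z => (α₃ : ℂ) * z 0 ^ 2 - (α₁ : ℂ) * z 1 ^ 2)
      (fun z => (analyticAt_const.mul ((analyticAt_coord 0 z).pow 2)).sub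
        (analyticAt_const.mul ((analyticAt_coord 1 z).pow 2)))
      (fun t y => by simp; ring) (v := ![0, 1]) (by simpa using h1) fun z => ?_
    rw [(hder z).fderiv]
    simp [truncatedPlanarField, h4]
    ring
  have h3 : α₃ = 0 := by tauto
  refine planar_integrable_of_commuting (k := 1) (g := fun z => ![z 0, 0])
    (fun z => ?_) (fun t y => ?_) (v := ![1, 1]) (by simpa [truncatedPlanarField, h3] using h4)
    fun z => ?_
  · refine AnalyticAt.pi fun i => ?_
    fin_cases i
    · exact analyticAt_coord 0 z
    · exact analyticAt_const
  · ext i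
    fin_cases i <;> simp
  · have hg : HasFDerivAt (fun z : Fin 2 → ℂ => (![z 0, 0] : Fin 2 → ℂ))
        (ContinuousLinearMap.pi ![coordForm 0, 0]) z := by
      refine hasFDerivAt_pi'' fun i => ?_
      fin_cases i
      · exact hasFDerivAt_coord 0 z
      · exact hasFDerivAt_const _ _
    rw [hg.fderiv, fderiv_truncatedPlanarField]
    ext i
    fin_cases i
    · simp [truncatedPlanarField]
      ring
    · simp [h3]

/-! ### Homogeneous polynomials in two variables -/

section Homogenization

open Polynomial

/-- The binary form of degree `n` that dehomogenizes to `A`, for `A` of degree at most `n`. -/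
noncomputable def binaryForm (n : ℕ) (A : ℂ[X]) (z : Fin 2 → ℂ) : ℂ :=
  ∑ i ∈ Finset.range (n + 1), A.coeff i * z 0 ^ (n - i) * z 1 ^ i

theorem analyticAt_binaryForm (n : ℕ) (A : ℂ[X]) (z : Fin 2 → ℂ) :
    AnalyticAt ℂ (binaryForm n A) z :=
  Finset.analyticAt_fun_sum _ fun i _ =>
    (analyticAt_const.mul ((analyticAt_coord 0 z).pow _)).mul ((analyticAt_coord 1 z).pow i)

theorem binaryForm_differentiable (n : ℕ) (A : ℂ[X]) : Differentiable ℂ (binaryForm n A) :=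
  fun z => (analyticAt_binaryForm n A z).differentiableAt

theorem binaryForm_homogeneous (n : ℕ) (A : ℂ[X]) : HomogeneousOfDegree n (binaryForm n A) := by
  intro t z
  simp only [binaryForm, Pi.smul_apply, smul_eq_mul, Finset.mul_sum]
  refine Finset.sum_congr rfl fun i hi => ?_
  have hi' : i ≤ n := Nat.lt_succ_iff.1 (Finset.mem_range.1 hi)
  rw [mul_pow, mul_pow, ← Nat.sub_add_cancel hi', pow_add t, Nat.sub_add_cancel hi']
  ring

theorem binaryForm_one {n : ℕ} {A : ℂ[X]} (hA : A.natDegree ≤ n) (x : ℂ) :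
    binaryForm n A ![1, x] = A.eval x := by
  rw [Polynomial.eval_eq_sum_range' (Nat.lt_succ_iff.2 hA)]
  simp [binaryForm]

theorem dense_coord_ne_zero : Dense {z : Fin 2 → ℂ | z 0 ≠ 0} := by
  have h : HomogeneousOfDegree 1 fun z : Fin 2 → ℂ => z 0 := fun t y => by simp
  exact Measure.dense_of_ae (h.ae_ne_zero (coordForm 0).differentiable (v := ![1, 0]) (by simp))

/-- Continuous homogeneous functions on `ℂ²` of the same degree agree if they do on the line
`z₀ = 1`. -/
theorem HomogeneousOfDegree.eq_of_eq_on_line {E : Type*} [NormedAddCommGroup E] [NormedSpace ℂ E]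
    {k : ℕ} {f g : (Fin 2 → ℂ) → E} (hf : HomogeneousOfDegree k f) (hg : HomogeneousOfDegree k g)
    (cf : Continuous f) (cg : Continuous g) (h : ∀ x, f ![1, x] = g ![1, x]) : f = g := by
  refine cf.ext_on dense_coord_ne_zero cg fun z hz => ?_
  have hz' : z = z 0 • ![1, z 1 / z 0] := by
    ext i
    fin_cases i
    · simp
    · simp [mul_div_cancel₀ _ (show z 0 ≠ 0 from hz)]
  rw [hz', hf, hg, h]

/-- Along an affine line the homogeneous parts of a power series are polynomial. -/
theorem exists_polynomial_homPart_line {V E : Type*} [NormedAddCommGroup V] [NormedSpace ℂ V]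
    [NormedAddCommGroup E] [NormedSpace ℂ E] (p : FormalMultilinearSeries ℂ V E) (k : ℕ)
    (l : E →L[ℂ] ℂ) (a b : V) :
    ∃ A : ℂ[X], A.natDegree ≤ k ∧ ∀ x : ℂ, l (homPart p k (a + x • b)) = A.eval x := by
  refine ⟨∑ s : Finset (Fin k), C (l (p k (s.piecewise (fun _ => b) fun _ => a))) * X ^ s.card,
    ?_, fun x => ?_⟩
  · refine natDegree_sum_le_of_forall_le _ _ fun s _ => (natDegree_C_mul_X_pow_le _ _).trans ?_
    simpa using s.card_le_univ
  · have h1 : homPart p k (a + x • b) =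
        ∑ s : Finset (Fin k), p k (s.piecewise (fun _ => x • b) fun _ => a) := by
      rw [homPart, add_comm]
      exact (p k).toMultilinearMap.map_add_univ (fun _ => x • b) fun _ => a
    rw [h1, map_sum, eval_finsetSum]
    refine Finset.sum_congr rfl fun s _ => ?_
    have h2 : p k (s.piecewise (fun _ => x • b) fun _ => a) =
        (∏ _i ∈ s, x) • p k (s.piecewise (fun _ => b) fun _ => a) := by
      have := (p k).toMultilinearMap.map_piecewise_smul (fun _ => x)
        (s.piecewise (fun _ => b) fun _ => a) s
      have h3 : (s.piecewise (fun _ => x • b) fun _ => a) = s.piecewise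
          (fun i => x • s.piecewise (fun _ => b) (fun _ => a) i)
          (s.piecewise (fun _ => b) fun _ => a) := by
        ext i
        by_cases hi : i ∈ s <;> simp [hi]
      rw [h3]
      exact this
    rw [h2, Finset.prod_const, map_smul, eval_mul, eval_C, eval_pow, eval_X, smul_eq_mul, mul_comm]

end Homogenization

/-! ### Rigidity of commuting fields of a non-integrable planar system -/

section PlanarRigidity

open Polynomial

variable {α₁ α₃ α₄ : ℝ}

/-- A non-integrable planar system has no nonzero binary form of positive degree as a first
integral. -/
theorem eq_zero_of_binaryForm_firstIntegral (h1 : α₁ ≠ 0)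
    (hni : ¬ AnalyticallyIntegrableNearZero 2 (truncatedPlanarField α₁ α₃ α₄)) {n : ℕ}
    {A : ℂ[X]} (hA : A.natDegree ≤ n) (hn : n ≠ 0)
    (hint : ∀ z, fderiv ℂ (binaryForm n A) z (truncatedPlanarField α₁ α₃ α₄ z) = 0) : A = 0 := by
  by_contra hne
  obtain ⟨x, hx⟩ : ∃ x, A.eval x ≠ 0 := by
    by_contra! hcon
    exact hne (Polynomial.funext fun x => by rw [hcon, eval_zero])
  exact hni (planar_integrable_of_firstIntegral (fun h => h1 h.1) hn (analyticAt_binaryForm n A)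
    (binaryForm_homogeneous n A) (v := ![1, x]) (by rwa [binaryForm_one hA]) hint)

/-- If the planar system is not integrable, the only homogeneous polynomial fields commuting
with it are its constant multiples.  The components of `P` are coprime, so that a field parallel
to `P` is a polynomial multiple `h P`, and `h` is a first integral. -/
theorem planar_commuting_rigidity (h1 : α₁ ≠ 0) (h3 : α₃ ≠ 0) (h4 : α₄ ≠ 0)
    (hni : ¬ AnalyticallyIntegrableNearZero 2 (truncatedPlanarField α₁ α₃ α₄)) {k : ℕ}
    {g : (Fin 2 → ℂ) → (Fin 2 → ℂ)} (hA : ∀ z, AnalyticAt ℂ g z) (hg : HomogeneousOfDegree k g)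
    {A B : ℂ[X]} (hBk : B.natDegree ≤ k) (hgA : ∀ x, g ![1, x] 0 = A.eval x)
    (hgB : ∀ x, g ![1, x] 1 = B.eval x)
    (hcomm : ∀ z, fderiv ℂ g z (truncatedPlanarField α₁ α₃ α₄ z) =
      fderiv ℂ (truncatedPlanarField α₁ α₃ α₄) z (g z)) :
    ∃ c : ℂ, (c = 0 ∨ k = 2) ∧ ∀ z, g z = c • truncatedPlanarField α₁ α₃ α₄ z := by
  have h1' : (α₁ : ℂ) ≠ 0 := by exact_mod_cast h1
  have h3' : (α₃ : ℂ) ≠ 0 := by exact_mod_cast h3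
  have h4' : (α₄ : ℂ) ≠ 0 := by exact_mod_cast h4
  set P := truncatedPlanarField α₁ α₃ α₄ with hP
  have cg : Continuous g := continuous_iff_continuousAt.2 fun z => (hA z).continuousAt
  have hdP : Differentiable ℂ P := fun z =>
    (analyticAt_truncatedPlanarField α₁ α₃ α₄ z).differentiableAt
  have hdet : ∀ v, P v 0 * g v 1 - P v 1 * g v 0 = 0 := fun v => by
    by_contra hv
    exact hni (planar_integrable_of_commuting hA hg hv hcomm)
  have hpoly : C (α₁ : ℂ) * X * B = (C (α₃ : ℂ) + C (α₄ : ℂ) * X ^ 2) * A := by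
    refine Polynomial.funext fun x => ?_
    have := hdet ![1, x]
    rw [hgA, hgB] at this
    simp only [hP, truncatedPlanarField, Matrix.cons_val_zero, Matrix.cons_val_one] at this
    simp only [eval_mul, eval_add, eval_C, eval_X, eval_pow]
    linear_combination this
  obtain ⟨A', rfl⟩ : X ∣ A := by
    rw [X_dvd_iff, coeff_zero_eq_eval_zero]
    have := congrArg (eval 0) hpoly
    simp only [eval_mul, eval_add, eval_C, eval_X, eval_pow] at this
    have h : (α₃ : ℂ) * eval 0 A = 0 := by linear_combination -this
    exact (mul_eq_zero.1 h).resolve_left h3'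
  have hB : C (α₁ : ℂ) * B = (C (α₃ : ℂ) + C (α₄ : ℂ) * X ^ 2) * A' := by
    refine mul_left_cancel₀ (X_ne_zero (R := ℂ)) ?_
    linear_combination hpoly
  let H : ℂ[X] := C (α₁ : ℂ)⁻¹ * A'
  have hAH : ∀ x, g ![1, x] 0 = α₁ * x * H.eval x := fun x => by
    rw [hgA]
    simp only [H, eval_mul, eval_C, eval_X]
    field_simp
  have hBH : B = (C (α₃ : ℂ) + C (α₄ : ℂ) * X ^ 2) * H := by
    refine mul_left_cancel₀ (C_ne_zero.2 h1') ?_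
    have : C (α₁ : ℂ) * C (α₁ : ℂ)⁻¹ = 1 := by rw [← C_mul, mul_inv_cancel₀ h1', C_1]
    rw [hB]
    simp only [H]
    linear_combination -(C (α₃ : ℂ) + C (α₄ : ℂ) * X ^ 2) * A' * this
  have hline : ∀ x, g ![1, x] = H.eval x • P ![1, x] := fun x => by
    ext i
    fin_cases i
    · simp only [Fin.zero_eta, hAH, hP, truncatedPlanarField, Pi.smul_apply, smul_eq_mul,
        Matrix.cons_val_zero, Matrix.cons_val_one]
      ring
    · simp only [Fin.mk_one, hgB, hBH, hP, truncatedPlanarField, Pi.smul_apply, smul_eq_mul,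
        Matrix.cons_val_zero, Matrix.cons_val_one, eval_mul, eval_add, eval_C, eval_X, eval_pow]
      ring
  by_cases hH : H = 0
  · refine ⟨0, Or.inl rfl, fun z => ?_⟩
    have : g = fun _ => 0 := hg.eq_of_eq_on_line (fun t y => (smul_zero _).symm) cg
      continuous_const fun x => by rw [hline, hH, eval_zero, zero_smul]
    rw [this, zero_smul]
  have hdeg : (C (α₃ : ℂ) + C (α₄ : ℂ) * X ^ 2).natDegree = 2 := by
    rw [add_comm]
    exact (natDegree_add_C).trans (natDegree_C_mul_X_pow 2 _ h4')
  have hne : C (α₃ : ℂ) + C (α₄ : ℂ) * X ^ 2 ≠ 0 := fun h => by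
    rw [h, natDegree_zero] at hdeg
    exact absurd hdeg (by norm_num)
  have hdegB : 2 + H.natDegree ≤ k := by
    rw [← hdeg, ← natDegree_mul hne hH, ← hBH]
    exact hBk
  obtain ⟨n, rfl⟩ : ∃ n, k = n + 2 := ⟨k - 2, by lia⟩
  have hHn : H.natDegree ≤ n := by lia
  have hgh : g = fun z => binaryForm n H z • P z := by
    refine hg.eq_of_eq_on_line (fun t y => ?_) cg
      ((binaryForm_differentiable n H).continuous.smul hdP.continuous) fun x => ?_
    · rw [binaryForm_homogeneous n H t y, hP, truncatedPlanarField_homogeneous α₁ α₃ α₄ t y,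
        smul_smul, smul_smul, smul_eq_mul, pow_add]
      ring_nf
    · rw [binaryForm_one hHn, hline]
  have hint : ∀ z, fderiv ℂ (binaryForm n H) z (P z) = 0 := by
    intro z
    by_cases hz : P z = 0
    · rw [hz, map_zero]
    have hd := (binaryForm_differentiable n H z).hasFDerivAt.fun_smul (hdP z).hasFDerivAt
    have h := hcomm z
    rw [hgh, hd.fderiv] at h
    simp only [add_apply, smul_apply, map_smul, ContinuousLinearMap.smulRight_apply,
      add_eq_left] at h
    exact (smul_eq_zero.1 h).resolve_right hz
  have hn : n = 0 := by
    by_contra hn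
    exact hH (eq_zero_of_binaryForm_firstIntegral h1 hni hHn hn hint)
  subst hn
  refine ⟨H.coeff 0, Or.inr rfl, fun z => ?_⟩
  rw [hgh]
  simp [binaryForm]

/-- The rotational component `b` of a field commuting with the normal form satisfies
`P b = α₁ x₃ b`, as the function `r` does.  So `b / r` is a first integral, and if the planar system
is not integrable, the only nonzero solutions vanishing on the axis `r = 0` are the multiples of
`r`. -/
theorem planar_rotational_rigidity (h1 : α₁ ≠ 0)
    (hni : ¬ AnalyticallyIntegrableNearZero 2 (truncatedPlanarField α₁ α₃ α₄)) {k : ℕ}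
    {b : (Fin 2 → ℂ) → ℂ} (cb : Continuous b) (hb : HomogeneousOfDegree k b)
    {B : ℂ[X]} (hBk : B.natDegree ≤ k) (hbB : ∀ x, b ![1, x] = B.eval x)
    (hb0 : b ![0, 1] = 0)
    (hrel : ∀ z, fderiv ℂ b z (truncatedPlanarField α₁ α₃ α₄ z) = α₁ * z 1 * b z) :
    (∀ z, b z = 0) ∨ (k = 1 ∧ ∃ d : ℂ, ∀ z, b z = d * z 0) := by
  set P := truncatedPlanarField α₁ α₃ α₄ with hP
  have hbform : b = binaryForm k B := hb.eq_of_eq_on_line (binaryForm_homogeneous k B) cb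
    (binaryForm_differentiable k B).continuous fun x => by rw [binaryForm_one hBk, hbB]
  have hcoeff : B.coeff k = 0 := by
    rw [hbform, binaryForm, Finset.sum_range_succ, Finset.sum_eq_zero] at hb0
    · simpa using hb0
    · intro i hi
      have : k - i ≠ 0 := by have := Finset.mem_range.1 hi; lia
      simp [this]
  rcases k with _ | n
  · refine Or.inl fun z => ?_
    rw [hbform, binaryForm]
    simp [hcoeff]
  have hBn : B.natDegree ≤ n := by
    refine natDegree_le_iff_coeff_eq_zero.2 fun i hi => ?_
    rcases Nat.lt_or_ge (n + 1) i with h | h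
    · exact coeff_eq_zero_of_natDegree_lt (lt_of_le_of_lt hBk h)
    · obtain rfl : i = n + 1 := by lia
      exact hcoeff
  have hbz : b = fun z => z 0 * binaryForm n B z := by
    have hh : HomogeneousOfDegree (n + 1) fun z : Fin 2 → ℂ => z 0 * binaryForm n B z := by
      intro t y
      simp only [binaryForm_homogeneous n B t y, Pi.smul_apply, smul_eq_mul]
      ring
    refine hb.eq_of_eq_on_line hh cb
      ((coordForm 0).continuous.mul (binaryForm_differentiable n B).continuous) fun x => ?_
    rw [hbB, binaryForm_one hBn]
    simp
  have hint : (fun z => fderiv ℂ (binaryForm n B) z (P z)) = fun _ => 0 := by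
    have hc : Continuous fun z => fderiv ℂ (binaryForm n B) z (P z) := by
      have c1 : Continuous (fderiv ℂ (binaryForm n B)) := continuous_iff_continuousAt.2 fun z =>
        (analyticAt_binaryForm n B z).fderiv.continuousAt
      have c2 : Continuous P := continuous_iff_continuousAt.2 fun z =>
        (analyticAt_truncatedPlanarField α₁ α₃ α₄ z).continuousAt
      exact c1.clm_apply c2
    refine hc.ext_on dense_coord_ne_zero continuous_const fun z hz => ?_
    have hd := (hasFDerivAt_coord 0 z).fun_mul (binaryForm_differentiable n B z).hasFDerivAt
    have h := hrel z
    rw [hbz, hd.fderiv] at h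
    have hP0 : P z 0 = α₁ * z 0 * z 1 := rfl
    simp only [add_apply, smul_apply, smul_eq_mul, ContinuousLinearMap.proj_apply, hP0] at h
    have : z 0 * fderiv ℂ (binaryForm n B) z (P z) = 0 := by linear_combination h
    exact (mul_eq_zero.1 this).resolve_left hz
  by_cases hn : n = 0
  · subst hn
    refine Or.inr ⟨rfl, B.coeff 0, fun z => ?_⟩
    rw [hbz]
    simp [binaryForm, mul_comm]
  · have hB := eq_zero_of_binaryForm_firstIntegral h1 hni hBn hn (congrFun hint)
    refine Or.inl fun z => ?_
    rw [hbz, hB]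
    simp [binaryForm]

end PlanarRigidity

/-! ### The quadratic normal form and its rotational symmetry -/

section NormalForm

/-- The infinitesimal rotation `(y₀, y₁, y₂) ↦ (-y₁, y₀, 0)`. -/
noncomputable def rotGen : (Fin 3 → ℂ) →L[ℂ] (Fin 3 → ℂ) :=
  ContinuousLinearMap.pi ![-coordForm 1, coordForm 0, 0]

/-- The rotation by the complex angle `ω t` in the first two coordinates. -/
noncomputable def rotFlow (ω t : ℂ) : (Fin 3 → ℂ) →L[ℂ] (Fin 3 → ℂ) :=
  Complex.cos (ω * t) • ContinuousLinearMap.pi ![coordForm 0, coordForm 1, 0] +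
    Complex.sin (ω * t) • rotGen + ContinuousLinearMap.pi ![0, 0, coordForm 2]

theorem rotGen_apply (y : Fin 3 → ℂ) : rotGen y = ![-y 1, y 0, 0] := by
  ext i
  fin_cases i <;> simp [rotGen]

theorem rotFlow_apply (ω t : ℂ) (y : Fin 3 → ℂ) : rotFlow ω t y =
    ![Complex.cos (ω * t) * y 0 - Complex.sin (ω * t) * y 1,
      Complex.sin (ω * t) * y 0 + Complex.cos (ω * t) * y 1, y 2] := by
  ext i
  fin_cases i
  · simp [rotFlow, rotGen]
    ring
  · simp [rotFlow, rotGen]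
    ring
  · simp [rotFlow, rotGen]

theorem rotFlow_zero (ω : ℂ) : rotFlow ω 0 = 1 := by
  ext y i
  fin_cases i <;> simp [rotFlow_apply]

theorem rotFlow_period {ω : ℂ} (hω : ω ≠ 0) : rotFlow ω (2 * Real.pi / ω) = 1 := by
  have : ω * (2 * Real.pi / ω) = 2 * Real.pi := by field_simp
  ext y i
  fin_cases i <;> simp [rotFlow_apply, this]

theorem rotFlow_neg_period {ω : ℂ} (hω : ω ≠ 0) : rotFlow ω (-(2 * Real.pi / ω)) = 1 := by
  have : ω * (-(2 * Real.pi / ω)) = -(2 * Real.pi) := by field_simp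
  ext y i
  fin_cases i <;> simp [rotFlow_apply, this]

theorem hasDerivAt_rotFlow (ω t : ℂ) :
    HasDerivAt (rotFlow ω) ((ω • rotGen).comp (rotFlow ω t)) t := by
  have h0 : HasDerivAt (fun t : ℂ => ω * t) ω t := by
    simpa using (hasDerivAt_id t).const_mul ω
  have h := ((h0.ccos.smul_const (ContinuousLinearMap.pi ![coordForm 0, coordForm 1, 0] :
    (Fin 3 → ℂ) →L[ℂ] (Fin 3 → ℂ))).add (h0.csin.smul_const rotGen)).add_const
      (ContinuousLinearMap.pi ![0, 0, coordForm 2])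
  refine h.congr_deriv ?_
  ext y i
  fin_cases i
  · simp [rotFlow_apply, rotGen]
    ring
  · simp [rotFlow_apply, rotGen]
    ring
  · simp [rotFlow_apply, rotGen]

theorem hasDerivAt_rotFlow_neg (ω t : ℂ) :
    HasDerivAt (fun t => rotFlow ω (-t)) (-(rotFlow ω (-t)).comp (ω • rotGen)) t := by
  have h := (hasDerivAt_rotFlow ω (-t)).scomp t (hasDerivAt_neg t)
  refine h.congr_deriv ?_
  ext y i
  fin_cases i
  · simp [rotFlow_apply, rotGen]
  · simp [rotFlow_apply, rotGen]
    exact Or.inl (by ring)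
  · simp [rotFlow_apply, rotGen]

/-- The quadratic part of the complexified normal form. -/
noncomputable def normalFormQuad (α₁ α₂ α₃ α₄ : ℝ) (y : Fin 3 → ℂ) : Fin 3 → ℂ :=
  ![α₁ * y 0 * y 2 - α₂ * y 1 * y 2, α₂ * y 0 * y 2 + α₁ * y 1 * y 2,
    α₃ * (y 0 ^ 2 + y 1 ^ 2) + α₄ * y 2 ^ 2]

variable (α₁ α₂ α₃ α₄ : ℝ)

theorem normalFormQuad_homogeneous :
    HomogeneousOfDegree 2 (normalFormQuad α₁ α₂ α₃ α₄) := fun t y => by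
  ext i
  fin_cases i
  all_goals
    simp [normalFormQuad]
    ring

theorem analyticAt_normalFormQuad (y : Fin 3 → ℂ) :
    AnalyticAt ℂ (normalFormQuad α₁ α₂ α₃ α₄) y := by
  have c := fun i => analyticAt_coord (n := 3) i y
  refine AnalyticAt.pi fun i => ?_
  fin_cases i
  · exact ((analyticAt_const.mul (c 0)).mul (c 2)).sub ((analyticAt_const.mul (c 1)).mul (c 2))
  · exact ((analyticAt_const.mul (c 0)).mul (c 2)).add ((analyticAt_const.mul (c 1)).mul (c 2))
  · exact (analyticAt_const.mul (((c 0).pow 2).add ((c 1).pow 2))).add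
      (analyticAt_const.mul ((c 2).pow 2))

theorem normalFormQuad_differentiable : Differentiable ℂ (normalFormQuad α₁ α₂ α₃ α₄) :=
  fun y => (analyticAt_normalFormQuad α₁ α₂ α₃ α₄ y).differentiableAt

theorem fderiv_normalFormQuad (y v : Fin 3 → ℂ) :
    fderiv ℂ (normalFormQuad α₁ α₂ α₃ α₄) y v =
      ![α₁ * (v 0 * y 2 + y 0 * v 2) - α₂ * (v 1 * y 2 + y 1 * v 2),
        α₂ * (v 0 * y 2 + y 0 * v 2) + α₁ * (v 1 * y 2 + y 1 * v 2),
        2 * (α₃ * (y 0 * v 0 + y 1 * v 1) + α₄ * y 2 * v 2)] := by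
  have c := fun i => hasFDerivAt_coord (n := 3) i y
  have hd := (normalFormQuad_differentiable α₁ α₂ α₃ α₄ y).hasFDerivAt
  have h := fun i => (hasFDerivAt_pi'.1 hd) i
  ext i
  fin_cases i
  · have h' := (((c 0).const_mul (α₁ : ℂ)).fun_mul (c 2)).fun_sub
      (((c 1).const_mul (α₂ : ℂ)).fun_mul (c 2))
    have := congrArg (fun L => L v) ((h 0).unique h')
    simp at this
    simp [this]
    ring
  · have h' := (((c 0).const_mul (α₂ : ℂ)).fun_mul (c 2)).fun_add
      (((c 1).const_mul (α₁ : ℂ)).fun_mul (c 2))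
    have := congrArg (fun L => L v) ((h 1).unique h')
    simp at this
    simp [this]
    ring
  · have h' := ((((c 0).pow 2).fun_add ((c 1).pow 2)).const_mul (α₃ : ℂ)).fun_add
      (((c 2).pow 2).const_mul (α₄ : ℂ))
    have := congrArg (fun L => L v) ((h 2).unique h')
    simp at this
    simp [this]
    ring

theorem fderiv_normalFormQuad_homogeneous :
    HomogeneousOfDegree 1 (fderiv ℂ (normalFormQuad α₁ α₂ α₃ α₄)) := fun t y => by
  ext v i
  rw [smul_apply, fderiv_normalFormQuad, fderiv_normalFormQuad]
  fin_cases i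
  all_goals
    simp
    ring

theorem normalFormQuad_rotFlow (ω t : ℂ) (y : Fin 3 → ℂ) :
    normalFormQuad α₁ α₂ α₃ α₄ (rotFlow ω t y) =
      rotFlow ω t (normalFormQuad α₁ α₂ α₃ α₄ y) := by
  have h := Complex.sin_sq_add_cos_sq (ω * t)
  rw [rotFlow_apply, rotFlow_apply]
  ext i
  fin_cases i
  · simp [normalFormQuad]
    ring
  · simp [normalFormQuad]
    ring
  · simp [normalFormQuad]
    exact Or.inl (by linear_combination (y 0 ^ 2 + y 1 ^ 2) * h)

theorem fderiv_normalFormQuad_rotFlow (ω t : ℂ) (y e : Fin 3 → ℂ) :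
    rotFlow ω (-t) (fderiv ℂ (normalFormQuad α₁ α₂ α₃ α₄) (rotFlow ω t y) e) =
      fderiv ℂ (normalFormQuad α₁ α₂ α₃ α₄) y (rotFlow ω (-t) e) := by
  have h := Complex.sin_sq_add_cos_sq (ω * t)
  rw [fderiv_normalFormQuad, fderiv_normalFormQuad, rotFlow_apply, rotFlow_apply,
    rotFlow_apply]
  ext i
  fin_cases i
  · simp
    linear_combination (α₁ * y 0 * e 2 - α₂ * y 1 * e 2) * h
  · simp
    linear_combination (α₁ * y 1 * e 2 + α₂ * y 0 * e 2) * h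
  · simp
    exact Or.inl (by ring)

theorem fderiv_normalFormQuad_rotGen (y : Fin 3 → ℂ) :
    fderiv ℂ (normalFormQuad α₁ α₂ α₃ α₄) y (rotGen y) =
      rotGen (normalFormQuad α₁ α₂ α₃ α₄ y) := by
  rw [fderiv_normalFormQuad, rotGen_apply, rotGen_apply]
  ext i
  fin_cases i
  · simp [normalFormQuad]
    ring
  · simp [normalFormQuad]
    ring
  · simp [mul_comm]

end NormalForm

/-! ### Restriction to the plane `y₁ = 0` -/

section Restriction

/-- The embedding `(r, x₃) ↦ (r, 0, x₃)` of the plane. -/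
noncomputable def planeEmb : (Fin 2 → ℂ) →L[ℂ] (Fin 3 → ℂ) :=
  ContinuousLinearMap.pi ![coordForm 0, 0, coordForm 1]

theorem planeEmb_apply (z : Fin 2 → ℂ) : planeEmb z = ![z 0, 0, z 1] := by
  ext i
  fin_cases i <;> simp [planeEmb]

theorem planeEmb_line (x : ℂ) : planeEmb ![1, x] = planeEmb ![1, 0] + x • planeEmb ![0, 1] := by
  ext i
  fin_cases i <;> simp [planeEmb_apply]

/-- Every real point lies on the rotation orbit of a point of the plane `y₁ = 0`. -/
theorem exists_rotFlow_eq_planeEmb {ω : ℂ} (hω : ω ≠ 0) (x : Fin 3 → ℝ) :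
    ∃ t z, rotFlow ω t (fun i => (x i : ℂ)) = planeEmb z := by
  let w : ℂ := ⟨x 0, x 1⟩
  have h0 : (x 0 : ℂ) = ‖w‖ * Complex.cos (Complex.arg w) := by
    rw [← Complex.ofReal_cos, ← Complex.ofReal_mul, Complex.norm_mul_cos_arg]
  have h1 : (x 1 : ℂ) = ‖w‖ * Complex.sin (Complex.arg w) := by
    rw [← Complex.ofReal_sin, ← Complex.ofReal_mul, Complex.norm_mul_sin_arg]
  refine ⟨-(Complex.arg w) / ω, ![‖w‖, x 2], ?_⟩
  have hθ : ω * (-(Complex.arg w : ℂ) / ω) = -(Complex.arg w) := by field_simp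
  have h := Complex.sin_sq_add_cos_sq (Complex.arg w)
  rw [rotFlow_apply, planeEmb_apply, hθ]
  ext i
  fin_cases i
  · simp only [h0, h1, Complex.cos_neg, Complex.sin_neg, Fin.zero_eta, Matrix.cons_val_zero]
    linear_combination (‖w‖ : ℂ) * h
  · simp only [h0, h1, Complex.cos_neg, Complex.sin_neg, Fin.mk_one, Matrix.cons_val_one,
      Matrix.cons_val_zero]
    ring
  · simp

/-- A rotation-equivariant entire map that vanishes on the plane `y₁ = 0` is zero. -/
theorem eq_zero_of_eq_zero_on_plane {E : Type*} [NormedAddCommGroup E] [NormedSpace ℂ E]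
    [CompleteSpace E] {ω : ℂ} (hω : ω ≠ 0) {A : E →L[ℂ] E} {ψ : ℂ → E →L[ℂ] E}
    (hψ : ∀ t, HasDerivAt ψ (-(ψ t).comp A) t) (hψ0 : ψ 0 = 1) {w : (Fin 3 → ℂ) → E}
    (hw : Differentiable ℂ w) (hS : ∀ y, fderiv ℂ w y ((ω • rotGen) y) = A (w y))
    (h0 : ∀ z, w (planeEmb z) = 0) (y : Fin 3 → ℂ) : w y = 0 := by
  refine eq_zero_of_forall_real hw (fun x => ?_) y
  obtain ⟨t, z, htz⟩ := exists_rotFlow_eq_planeEmb hω x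
  rw [← transport_eq_self (hasDerivAt_rotFlow ω) hψ (rotFlow_zero ω) hψ0 hw hS t, htz, h0,
    map_zero]

variable {α₁ α₂ α₃ α₄ : ℝ}

/-- On the plane `y₁ = 0`, the normal form differs from the planar field by an infinitesimal
rotation. -/
theorem planeEmb_truncatedPlanarField (z : Fin 2 → ℂ) :
    planeEmb (truncatedPlanarField α₁ α₃ α₄ z) =
      normalFormQuad α₁ α₂ α₃ α₄ (planeEmb z) - (α₂ * z 1) • rotGen (planeEmb z) := by
  rw [rotGen_apply, planeEmb_apply, planeEmb_apply]
  ext i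
  fin_cases i
  · simp [truncatedPlanarField, normalFormQuad]
  · simp [normalFormQuad]
    ring
  · simp [truncatedPlanarField, normalFormQuad]

theorem fderiv_comp_planeEmb {E : Type*} [NormedAddCommGroup E] [NormedSpace ℂ E]
    {w : (Fin 3 → ℂ) → E} (hw : Differentiable ℂ w) (z v : Fin 2 → ℂ) :
    fderiv ℂ (fun z => w (planeEmb z)) z v = fderiv ℂ w (planeEmb z) (planeEmb v) := by
  have : HasFDerivAt (fun z => w (planeEmb z)) ((fderiv ℂ w (planeEmb z)).comp planeEmb) z :=
    (hw _).hasFDerivAt.comp z planeEmb.hasFDerivAt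
  rw [this.fderiv]
  rfl

/-- A rotation-invariant first integral of the quadratic normal form restricts to a first integral
of the planar field. -/
theorem firstIntegral_restrict {F : (Fin 3 → ℂ) → ℂ} (hF : Differentiable ℂ F)
    (hJ : ∀ y, fderiv ℂ F y (rotGen y) = 0)
    (hX : ∀ y, fderiv ℂ F y (normalFormQuad α₁ α₂ α₃ α₄ y) = 0) (z : Fin 2 → ℂ) :
    fderiv ℂ (fun z => F (planeEmb z)) z (truncatedPlanarField α₁ α₃ α₄ z) = 0 := by
  rw [fderiv_comp_planeEmb hF, planeEmb_truncatedPlanarField (α₂ := α₂), map_sub, map_smul, hJ, hX,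
    smul_zero, sub_zero]

/-- The planar derivative of a field commuting with the rotation and the quadratic normal form. -/
theorem commuting_restrict {g : (Fin 3 → ℂ) → (Fin 3 → ℂ)} (hg : Differentiable ℂ g)
    (hJ : ∀ y, fderiv ℂ g y (rotGen y) = rotGen (g y))
    (hX : ∀ y, fderiv ℂ g y (normalFormQuad α₁ α₂ α₃ α₄ y) =
      fderiv ℂ (normalFormQuad α₁ α₂ α₃ α₄) y (g y)) (z : Fin 2 → ℂ) :
    fderiv ℂ (fun z => g (planeEmb z)) z (truncatedPlanarField α₁ α₃ α₄ z) =
      ![α₁ * (g (planeEmb z) 0 * z 1 + z 0 * g (planeEmb z) 2),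
        α₂ * z 0 * g (planeEmb z) 2 + α₁ * z 1 * g (planeEmb z) 1,
        2 * (α₃ * z 0 * g (planeEmb z) 0 + α₄ * z 1 * g (planeEmb z) 2)] := by
  rw [fderiv_comp_planeEmb hg, planeEmb_truncatedPlanarField (α₂ := α₂), map_sub, map_smul, hJ, hX,
    fderiv_normalFormQuad, rotGen_apply]
  have e0 : planeEmb z 0 = z 0 := rfl
  have e1 : planeEmb z 1 = 0 := rfl
  have e2 : planeEmb z 2 = z 1 := rfl
  ext i
  fin_cases i
  · simp [e0, e1, e2]
    ring
  · simp [e0, e1, e2]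
    ring
  · simp [e0, e1, e2]
    ring

end Restriction

/-! ### Integrability data of a system in quadratic normal form -/

section NormalFormIntegrability

open Asymptotics

variable {ω : ℂ} {α₁ α₂ α₃ α₄ : ℝ} {Y : (Fin 3 → ℂ) → (Fin 3 → ℂ)}

/-- A nonconstant analytic first integral has a leading part whose restriction to the plane is a
first integral of the planar system. -/
theorem planar_integrable_of_analytic_firstIntegral (hω : ω ≠ 0)
    (hα : ¬ (α₁ = 0 ∧ α₃ = 0 ∧ α₄ = 0))
    (hY : (fun y => Y y - ((ω • rotGen) y + normalFormQuad α₁ α₂ α₃ α₄ y)) =O[𝓝 0]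
      fun y => ‖y‖ ^ 3)
    {F : (Fin 3 → ℂ) → ℂ} (hF : AnalyticAt ℂ F 0) (hconst : ¬ ∀ᶠ y in 𝓝 0, F y = F 0)
    (hrel : ∀ᶠ y in 𝓝 0, fderiv ℂ F y (Y y) = 0) :
    AnalyticallyIntegrableNearZero 2 (truncatedPlanarField α₁ α₃ α₄) := by
  obtain ⟨p, hp⟩ : AnalyticAt ℂ (fun y => F y - F 0) 0 := hF.sub analyticAt_const
  obtain ⟨k, ⟨y₀, hy₀⟩, hk⟩ := hp.exists_leading_homPart
    (fun h => hconst (h.mono fun y hy => sub_eq_zero.1 hy))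
  have hψ : ∀ t : ℂ, HasDerivAt (fun _ : ℂ => (1 : ℂ →L[ℂ] ℂ))
      (-(1 : ℂ →L[ℂ] ℂ).comp (0 : ℂ →L[ℂ] ℂ)) t :=
    fun t => (hasDerivAt_const t _).congr_deriv (by simp)
  have hT : (2 * Real.pi / ω : ℂ) ≠ 0 :=
    div_ne_zero (mul_ne_zero two_ne_zero (by exact_mod_cast Real.pi_ne_zero)) hω
  obtain ⟨hS, hX⟩ := hp.leading_homPart_relations (B := 0) (B₁ := 0) (A := 0) hk
    (normalFormQuad_homogeneous α₁ α₂ α₃ α₄) (fun t y => by simp) hY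
    (by simpa using isBigO_zero _ _)
    (hrel.mono fun y hy => by
      rw [fderiv_sub_const, hy]
      rfl)
    (hasDerivAt_rotFlow ω) hψ (rotFlow_zero ω) rfl hT (rotFlow_period hω) rfl
    (normalFormQuad_rotFlow α₁ α₂ α₃ α₄ ω) (fun _ _ _ => rfl)
  have hd := homPart_differentiable p k
  have hJ : ∀ y, fderiv ℂ (homPart p k) y (rotGen y) = 0 := fun y => by
    have := hS y
    rw [smul_apply, map_smul, zero_apply] at this
    exact (smul_eq_zero.1 this).resolve_left hω
  have hk0 : k ≠ 0 := by
    rintro rfl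
    refine hy₀ ?_
    have := hp.coeff_zero fun _ => y₀
    rw [sub_self] at this
    exact this
  obtain ⟨z, hz⟩ : ∃ z, homPart p k (planeEmb z) ≠ 0 := by
    by_contra! hcon
    exact hy₀ (eq_zero_of_eq_zero_on_plane hω hψ rfl hd hS hcon y₀)
  refine planar_integrable_of_firstIntegral hα hk0 (H := fun z => homPart p k (planeEmb z))
    (fun z => ?_) (fun t y => ?_) hz
    (firstIntegral_restrict hd hJ fun y => (hX y).trans rfl)
  · exact (((homPart_contDiff p k).contDiffAt.analyticAt)).comp (planeEmb.analyticAt z)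
  · simp only [map_smul, homPart_homogeneous p k t]

/-- If the planar system is not integrable, then an analytic field commuting with a system in
quadratic normal form has the leading part of the system's rotation or of its quadratic part. -/
theorem leading_homPart_of_commuting (hω : ω ≠ 0) (h1 : α₁ ≠ 0) (h3 : α₃ ≠ 0) (h4 : α₄ ≠ 0)
    (hni : ¬ AnalyticallyIntegrableNearZero 2 (truncatedPlanarField α₁ α₃ α₄))
    (hYa : AnalyticAt ℂ Y 0)
    (hY : (fun y => Y y - ((ω • rotGen) y + normalFormQuad α₁ α₂ α₃ α₄ y)) =O[𝓝 0]
      fun y => ‖y‖ ^ 3)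
    {u : (Fin 3 → ℂ) → (Fin 3 → ℂ)} {p : FormalMultilinearSeries ℂ (Fin 3 → ℂ) (Fin 3 → ℂ)}
    (hp : HasFPowerSeriesAt u p 0)
    (hrel : ∀ᶠ y in 𝓝 0, fderiv ℂ u y (Y y) = fderiv ℂ Y y (u y)) {k : ℕ}
    (hne : ∃ y, homPart p k y ≠ 0) (hk : ∀ j < k, ∀ y, homPart p j y = 0) :
    (k = 1 ∧ ∃ d : ℂ, ∀ y, homPart p k y = d • rotGen y) ∨
      (k = 2 ∧ ∃ c : ℂ, ∀ y, homPart p k y = c • normalFormQuad α₁ α₂ α₃ α₄ y) := by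
  have hT : (2 * Real.pi / ω : ℂ) ≠ 0 :=
    div_ne_zero (mul_ne_zero two_ne_zero (by exact_mod_cast Real.pi_ne_zero)) hω
  have hdX := normalFormQuad_differentiable α₁ α₂ α₃ α₄
  have hDY : (fun y => fderiv ℂ Y y - (ω • rotGen + fderiv ℂ (normalFormQuad α₁ α₂ α₃ α₄) y))
      =O[𝓝 0] fun y => ‖y‖ ^ 2 := by
    have hdY : ∀ᶠ y in 𝓝 0, DifferentiableAt ℂ Y y :=
      hYa.eventually_analyticAt.mono fun y hy => hy.differentiableAt
    refine (isBigO_fderiv_of_isBigO_norm_pow ?_ hY).congr' ?_ Filter.EventuallyEq.rfl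
    · exact hdY.mono fun y hy => hy.sub ((ω • rotGen).differentiableAt.add (hdX y))
    · filter_upwards [hdY] with y hy
      exact (hy.hasFDerivAt.fun_sub
        ((ω • rotGen).hasFDerivAt.fun_add (hdX y).hasFDerivAt)).fderiv
  have hψ := hasDerivAt_rotFlow_neg ω
  have hψ0 : rotFlow ω (-0) = 1 := by rw [neg_zero, rotFlow_zero]
  obtain ⟨hS, hX⟩ := hp.leading_homPart_relations hk
    (normalFormQuad_homogeneous α₁ α₂ α₃ α₄) (fderiv_normalFormQuad_homogeneous α₁ α₂ α₃ α₄)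
    hY hDY hrel (hasDerivAt_rotFlow ω) hψ (rotFlow_zero ω) hψ0 hT
    (rotFlow_period hω) (rotFlow_neg_period hω) (normalFormQuad_rotFlow α₁ α₂ α₃ α₄ ω)
    (fderiv_normalFormQuad_rotFlow α₁ α₂ α₃ α₄ ω)
  set g := homPart p k with hg
  have hd : Differentiable ℂ g := homPart_differentiable p k
  have hhom : HomogeneousOfDegree k g := homPart_homogeneous p k
  have hA : ∀ z, AnalyticAt ℂ (fun z => g (planeEmb z)) z := fun z =>
    (homPart_contDiff p k).contDiffAt.analyticAt.comp (planeEmb.analyticAt z)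
  have hJ : ∀ y, fderiv ℂ g y (rotGen y) = rotGen (g y) := fun y => by
    have := hS y
    rw [smul_apply, smul_apply, map_smul] at this
    exact smul_right_injective _ hω this
  have hres := commuting_restrict hd hJ hX
  have hcoord : ∀ (i : Fin 3) z, fderiv ℂ (fun z => g (planeEmb z) i) z
      (truncatedPlanarField α₁ α₃ α₄ z) =
      fderiv ℂ (fun z => g (planeEmb z)) z (truncatedPlanarField α₁ α₃ α₄ z) i := fun i z => by
    rw [(hasFDerivAt_pi'.1 (hA z).differentiableAt.hasFDerivAt i).fderiv]
    rfl
  have hlin : ∀ (i : Fin 3), ∃ A : Polynomial ℂ, A.natDegree ≤ k ∧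
      ∀ x, g (planeEmb ![1, x]) i = A.eval x := fun i => by
    obtain ⟨A, hAk, hAx⟩ := exists_polynomial_homPart_line p k (coordForm i) (planeEmb ![1, 0])
      (planeEmb ![0, 1])
    exact ⟨A, hAk, fun x => by rw [← hAx, planeEmb_line]; rfl⟩
  obtain ⟨A, -, hAx⟩ := hlin 0
  obtain ⟨B, hBk, hBx⟩ := hlin 1
  obtain ⟨C, hCk, hCx⟩ := hlin 2
  -- the planar components are a multiple of the planar field
  obtain ⟨c, hck, hc⟩ := planar_commuting_rigidity h1 h3 h4 hni
    (g := fun z => ![g (planeEmb z) 0, g (planeEmb z) 2]) (k := k)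
    (fun z => by
      refine AnalyticAt.pi fun i => ?_
      fin_cases i
      · exact (coordForm 0).analyticAt _ |>.comp (hA z)
      · exact (coordForm 2).analyticAt _ |>.comp (hA z))
    (fun t y => by
      ext i
      fin_cases i <;> simp [hhom t])
    hCk hAx hCx
    (fun z => by
      have hd2 : HasFDerivAt (fun z => ![g (planeEmb z) 0, g (planeEmb z) 2])
          (ContinuousLinearMap.pi ![fderiv ℂ (fun z => g (planeEmb z) 0) z,
            fderiv ℂ (fun z => g (planeEmb z) 2) z]) z := by
        refine hasFDerivAt_pi'' fun i => ?_
        have h := hasFDerivAt_pi'.1 (hA z).differentiableAt.hasFDerivAt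
        fin_cases i
        · exact (h 0).differentiableAt.hasFDerivAt
        · exact (h 2).differentiableAt.hasFDerivAt
      rw [hd2.fderiv, fderiv_truncatedPlanarField]
      ext i
      fin_cases i
      · simp only [Fin.zero_eta, ContinuousLinearMap.pi_apply, Matrix.cons_val_zero, hcoord, hres]
        simp
      · simp only [Fin.mk_one, ContinuousLinearMap.pi_apply, Matrix.cons_val_one,
          Matrix.cons_val_zero, hcoord, hres]
        simp)
  have hc0 : ∀ z, g (planeEmb z) 0 = c * (α₁ * z 0 * z 1) := fun z => congrFun (hc z) 0
  have hc2 : ∀ z, g (planeEmb z) 2 = c * (α₃ * z 0 ^ 2 + α₄ * z 1 ^ 2) :=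
    fun z => congrFun (hc z) 1
  -- the rotational component, after subtraction of that of the same multiple
  let b : (Fin 2 → ℂ) → ℂ := fun z => g (planeEmb z) 1 - c * α₂ * z 0 * z 1
  have hb := planar_rotational_rigidity h1 hni (k := k) (b := b)
    (B := B - Polynomial.C (c * α₂) * Polynomial.X)
    (by
      have : Continuous fun z => g (planeEmb z) 1 :=
        (coordForm 1).continuous.comp (hd.continuous.comp planeEmb.continuous)
      have c0 := (coordForm (n := 2) 0).continuous
      have c1 := (coordForm (n := 2) 1).continuous
      exact this.sub ((continuous_const.mul c0).mul c1))
    (fun t y => by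
      simp only [b, map_smul, hhom t, Pi.smul_apply, smul_eq_mul]
      rcases hck with rfl | rfl <;> ring)
    (by
      refine (Polynomial.natDegree_sub_le_of_le hBk ?_).trans_eq (max_self k)
      rcases hck with rfl | rfl
      · simp
      · exact (Polynomial.natDegree_C_mul_le _ _).trans (by simp))
    (fun x => by simp [b, hBx])
    (by
      -- on the rotation axis an equivariant field has no rotational component
      have h := congrFun (hJ (planeEmb ![0, 1])) 0
      have h0 : rotGen (planeEmb ![0, 1]) = 0 := by
        rw [rotGen_apply, planeEmb_apply]
        ext i
        fin_cases i <;> simp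
      rw [h0, map_zero, rotGen_apply] at h
      simpa [b] using h)
    (fun z => by
      have hq := (((hasFDerivAt_coord 0 z).const_mul (c * α₂)).fun_mul (hasFDerivAt_coord 1 z))
      have hbd := ((hasFDerivAt_pi'.1 (hA z).differentiableAt.hasFDerivAt
        1).differentiableAt.hasFDerivAt).fun_sub hq
      have hbd' : fderiv ℂ b z = _ := hbd.fderiv
      rw [hbd', sub_apply, hcoord, hres]
      simp only [b, hc2, hc0, add_apply, smul_apply, ContinuousLinearMap.proj_apply,
        truncatedPlanarField, Matrix.cons_val_zero, Matrix.cons_val_one, smul_eq_mul]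
      ring)
  -- an equivariant map is determined by its values on the plane
  have hext : ∀ G : (Fin 3 → ℂ) → (Fin 3 → ℂ), Differentiable ℂ G →
      (∀ y, fderiv ℂ G y (rotGen y) = rotGen (G y)) → (∀ z, g (planeEmb z) = G (planeEmb z)) →
      ∀ y, g y = G y := by
    intro G hG hGJ hGz y
    refine sub_eq_zero.1 (eq_zero_of_eq_zero_on_plane hω hψ hψ0 (w := fun y => g y - G y)
      (hd.sub hG) (fun y => ?_) (fun z => sub_eq_zero.2 (hGz z)) y)
    rw [fderiv_fun_sub (hd y) (hG y), smul_apply, smul_apply, map_smul, sub_apply, hJ, hGJ,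
      map_sub]
  rcases hb with hb | ⟨rfl, d, hb⟩
  · have hgX : ∀ y, g y = c • normalFormQuad α₁ α₂ α₃ α₄ y := by
      refine hext (fun y => c • normalFormQuad α₁ α₂ α₃ α₄ y) (hdX.const_smul c)
        (fun y => ?_) fun z => ?_
      · rw [fderiv_fun_const_smul (hdX y), smul_apply, fderiv_normalFormQuad_rotGen, map_smul]
      · have hbz := hb z
        ext i
        rw [planeEmb_apply]
        fin_cases i
        · have := hc0 z
          rw [planeEmb_apply] at this
          simp [this, normalFormQuad]
        · simp only [b, planeEmb_apply] at hbz
          simp [normalFormQuad]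
          linear_combination hbz
        · have := hc2 z
          rw [planeEmb_apply] at this
          simp [this, normalFormQuad]
    refine Or.inr ⟨hck.resolve_left ?_, c, hgX⟩
    rintro rfl
    obtain ⟨y, hy⟩ := hne
    exact hy (by rw [hgX, zero_smul])
  · have hc' : c = 0 := hck.resolve_right (by norm_num)
    subst hc'
    refine Or.inl ⟨rfl, d, hext (fun y => d • rotGen y) (rotGen.differentiable.const_smul d)
      (fun y => ?_) fun z => ?_⟩
    · rw [fderiv_fun_const_smul rotGen.differentiableAt, smul_apply,
        ContinuousLinearMap.fderiv, map_smul]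
    · have hbz := hb z
      simp only [b] at hbz
      have e0 := hc0 z
      have e2 := hc2 z
      have e1 : planeEmb z 1 = 0 := rfl
      have e3 : planeEmb z 0 = z 0 := rfl
      rw [rotGen_apply]
      ext i
      fin_cases i
      · simp [e0, e1]
      · simp [e3]
        linear_combination hbz
      · simp [e2]

/-- Three independent commuting analytic fields force the planar system to be integrable:
otherwise the leading parts of their combinations would span at most two dimensions. -/
theorem planar_integrable_of_three_commuting (hω : ω ≠ 0)
    (hα : ¬ (α₁ = 0 ∧ α₃ = 0 ∧ α₄ = 0)) (hYa : AnalyticAt ℂ Y 0)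
    (hY : (fun y => Y y - ((ω • rotGen) y + normalFormQuad α₁ α₂ α₃ α₄ y)) =O[𝓝 0]
      fun y => ‖y‖ ^ 3)
    {v : Fin 3 → (Fin 3 → ℂ) → (Fin 3 → ℂ)} (hv : ∀ j, AnalyticAt ℂ (v j) 0)
    (hrel : ∀ j, ∀ᶠ y in 𝓝 0, fderiv ℂ (v j) y (Y y) = fderiv ℂ Y y (v j y))
    (hli : ∀ c : Fin 3 → ℂ, c ≠ 0 → ¬ ∀ᶠ y in 𝓝 0, ∑ j, c j • v j y = 0) :
    AnalyticallyIntegrableNearZero 2 (truncatedPlanarField α₁ α₃ α₄) := by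
  by_contra hni
  have hα' : ¬ (α₁ = 0 ∨ α₃ = 0 ∨ α₄ = 0) := fun h =>
    hni (planar_integrable_of_coeff_eq_zero hα h)
  push Not at hα'
  obtain ⟨h1, h3, h4⟩ := hα'
  choose p hp using hv
  -- one linear functional detects the rotation, the other the quadratic part
  let e₁ : Fin 3 → ℂ := ![1, 0, 0]
  let e₃ : Fin 3 → ℂ := ![0, 0, 1]
  let M : Matrix (Fin 2) (Fin 3) ℂ := fun i j => ![homPart (p j) 1 e₁ 1, homPart (p j) 2 e₃ 2] i
  obtain ⟨c, hc0, hMc⟩ : ∃ c : Fin 3 → ℂ, c ≠ 0 ∧ M.mulVec c = 0 := by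
    have hker : LinearMap.ker M.mulVecLin ≠ ⊥ :=
      LinearMap.ker_ne_bot_of_finrank_lt (by simp)
    obtain ⟨c, hc, hne⟩ := (Submodule.ne_bot_iff _).1 hker
    exact ⟨c, hne, hc⟩
  have hq : HasFPowerSeriesAt (fun y => ∑ j, c j • v j y) (∑ j, c j • p j) 0 := by
    simp only [Fin.sum_univ_three]
    exact (((hp 0).const_smul (c := c 0)).add ((hp 1).const_smul (c := c 1))).add
      ((hp 2).const_smul (c := c 2))
  have hpart : ∀ k y, homPart (∑ j, c j • p j) k y = ∑ j, c j • homPart (p j) k y := by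
    intro k y
    simp only [Fin.sum_univ_three]
    rfl
  have hrel' : ∀ᶠ y in 𝓝 0, fderiv ℂ (fun y => ∑ j, c j • v j y) y (Y y) =
      fderiv ℂ Y y (∑ j, c j • v j y) := by
    have hdv : ∀ᶠ y in 𝓝 (0 : Fin 3 → ℂ), ∀ j, DifferentiableAt ℂ (v j) y :=
      Filter.eventually_all.2 fun j =>
        (hp j).analyticAt.eventually_analyticAt.mono fun y hy => hy.differentiableAt
    filter_upwards [hdv, Filter.eventually_all.2 hrel] with y hy hr
    have hfd : fderiv ℂ (fun y => ∑ j, c j • v j y) y = ∑ j, c j • fderiv ℂ (v j) y :=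
      (HasFDerivAt.fun_sum fun j _ => (hy j).hasFDerivAt.const_smul (c j)).fderiv
    rw [hfd, sum_apply, map_sum]
    refine Finset.sum_congr rfl fun j _ => ?_
    rw [smul_apply, hr, map_smul]
  obtain ⟨k, hne, hk⟩ := hq.exists_leading_homPart (hli c hc0)
  obtain ⟨y, hy⟩ := hne
  rcases leading_homPart_of_commuting hω h1 h3 h4 hni hYa hY hq hrel' ⟨y, hy⟩ hk with
    ⟨rfl, d, hd⟩ | ⟨rfl, d, hd⟩
  · have h := congrFun hMc 0
    have h' : ∑ j, c j • homPart (p j) 1 e₁ 1 = 0 := by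
      simpa [M, Matrix.mulVec, dotProduct, mul_comm] using h
    have hdz : d = 0 := by
      have := congrFun (hd e₁) 1
      rw [hpart, rotGen_apply, Finset.sum_apply] at this
      simp only [Pi.smul_apply] at this
      rw [h'] at this
      simpa [e₁] using this.symm
    exact hy (by rw [hd, hdz, zero_smul])
  · have h := congrFun hMc 1
    have h' : ∑ j, c j • homPart (p j) 2 e₃ 2 = 0 := by
      simpa [M, Matrix.mulVec, dotProduct, mul_comm] using h
    have hdz : d = 0 := by
      have := congrFun (hd e₃) 2
      rw [hpart, Finset.sum_apply] at this
      simp only [Pi.smul_apply] at this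
      rw [h'] at this
      simpa [e₃, normalFormQuad, h4] using this.symm
    exact hy (by rw [hd, hdz, zero_smul])

end NormalFormIntegrability

/-! ### Complexification of the normalizing transformation -/

section QuadraticMap

variable {𝕜 : Type*} [RCLike 𝕜]

/-- The polynomial map `𝕜³ → 𝕜³` with linear coefficients `a` and quadratic coefficients `b`. -/
def quadMap (a : Fin 3 → Fin 3 → 𝕜) (b : Fin 3 → Fin 3 → Fin 3 → 𝕜) (y : Fin 3 → 𝕜) :
    Fin 3 → 𝕜 :=
  fun i => ∑ j, a i j * y j + ∑ j, ∑ k, b i j k * (y j * y k)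

theorem analyticAt_quadMap (a : Fin 3 → Fin 3 → 𝕜) (b : Fin 3 → Fin 3 → Fin 3 → 𝕜)
    (y : Fin 3 → 𝕜) : AnalyticAt 𝕜 (quadMap a b) y := by
  have c : ∀ j : Fin 3, AnalyticAt 𝕜 (fun y : Fin 3 → 𝕜 => y j) y := fun j =>
    (ContinuousLinearMap.proj (R := 𝕜) (φ := fun _ : Fin 3 => 𝕜) j).analyticAt y
  refine AnalyticAt.pi fun i => AnalyticAt.add ?_ ?_
  · exact Finset.analyticAt_fun_sum _ fun j _ => analyticAt_const.mul (c j)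
  · exact Finset.analyticAt_fun_sum _ fun j _ => Finset.analyticAt_fun_sum _ fun k _ =>
      analyticAt_const.mul ((c j).mul (c k))

theorem fderiv_quadMap (a : Fin 3 → Fin 3 → 𝕜) (b : Fin 3 → Fin 3 → Fin 3 → 𝕜)
    (y v : Fin 3 → 𝕜) : fderiv 𝕜 (quadMap a b) y v =
      fun i => ∑ j, a i j * v j + ∑ j, ∑ k, b i j k * (v j * y k + y j * v k) := by
  have c : ∀ j : Fin 3, HasFDerivAt (fun y : Fin 3 → 𝕜 => y j)
      (ContinuousLinearMap.proj (R := 𝕜) (φ := fun _ : Fin 3 => 𝕜) j) y := fun j =>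
    (ContinuousLinearMap.proj (R := 𝕜) (φ := fun _ : Fin 3 => 𝕜) j).hasFDerivAt
  have h : HasFDerivAt (quadMap a b) (ContinuousLinearMap.pi fun i =>
      ∑ j, a i j • ContinuousLinearMap.proj (R := 𝕜) (φ := fun _ : Fin 3 => 𝕜) j +
      ∑ j, ∑ k, b i j k • (y j • ContinuousLinearMap.proj (R := 𝕜) (φ := fun _ : Fin 3 => 𝕜) k +
        y k • ContinuousLinearMap.proj (R := 𝕜) (φ := fun _ : Fin 3 => 𝕜) j)) y := by
    refine hasFDerivAt_pi'' fun i => HasFDerivAt.fun_add ?_ ?_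
    · exact HasFDerivAt.fun_sum fun j _ => (c j).const_mul (a i j)
    · exact HasFDerivAt.fun_sum fun j _ => HasFDerivAt.fun_sum fun k _ =>
        ((c j).fun_mul (c k)).const_mul (b i j k)
  rw [h.fderiv]
  ext i
  simp only [ContinuousLinearMap.pi_apply, add_apply, sum_apply, smul_apply,
    ContinuousLinearMap.proj_apply, smul_eq_mul]
  congr 1
  refine Finset.sum_congr rfl fun j _ => Finset.sum_congr rfl fun k _ => ?_
  ring

theorem quadMap_zero (a : Fin 3 → Fin 3 → 𝕜) (b : Fin 3 → Fin 3 → Fin 3 → 𝕜) :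
    quadMap a b 0 = 0 := by
  ext i
  simp [quadMap]

end QuadraticMap

section Taylor

open Asymptotics Filter

variable {V E : Type*} [NormedAddCommGroup V] [NormedSpace ℝ V]
  [NormedAddCommGroup E] [NormedSpace ℝ E]

theorem isBigO_of_isBigO_fderiv {R : V → E} {n : ℕ} (h0 : R 0 = 0)
    (hd : ∀ᶠ y in 𝓝 (0 : V), DifferentiableAt ℝ R y)
    (hR : fderiv ℝ R =O[𝓝 0] fun y => ‖y‖ ^ n) : R =O[𝓝 0] fun y => ‖y‖ ^ (n + 1) := by
  obtain ⟨C, hC0, hC⟩ := hR.exists_pos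
  rw [isBigOWith_iff] at hC
  obtain ⟨ε, hε, hball⟩ := Metric.eventually_nhds_iff_ball.1 (hC.and hd)
  refine IsBigO.of_bound C ?_
  rw [Metric.eventually_nhds_iff_ball]
  refine ⟨ε, hε, fun y hy => ?_⟩
  have hy' : ‖y‖ < ε := by simpa using hy
  have hmem : ∀ z ∈ Metric.closedBall (0 : V) ‖y‖, z ∈ Metric.ball (0 : V) ε := fun z hz => by
    have : ‖z‖ ≤ ‖y‖ := by simpa using hz
    simpa using lt_of_le_of_lt this hy'
  have := (convex_closedBall (0 : V) ‖y‖).norm_image_sub_le_of_norm_fderiv_le (𝕜 := ℝ) (f := R)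
    (C := C * ‖y‖ ^ n) (x := 0) (y := y) (fun z hz => (hball z (hmem z hz)).2) (fun z hz => ?_)
    (by simp) (by simp)
  · rw [h0, sub_zero, sub_zero] at this
    rw [Real.norm_of_nonneg (by positivity), pow_succ, ← mul_assoc]
    exact this
  · have h1 := (hball z (hmem z hz)).1
    have : ‖z‖ ≤ ‖y‖ := by simpa using hz
    rw [Real.norm_of_nonneg (by positivity)] at h1
    exact h1.trans (by gcongr)

theorem AnalyticAt.isBigO_sub_linear [CompleteSpace E] {G : V → E} (hG : AnalyticAt ℝ G 0) :
    (fun y => G y - (G 0 + fderiv ℝ G 0 y)) =O[𝓝 0] fun y => ‖y‖ ^ 2 := by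
  obtain ⟨q, hq⟩ := hG
  refine (hq.isBigO_sub_partialSum_pow 2).congr_left fun y => ?_
  have h0 : (q 0 fun _ => y) = G 0 := hq.coeff_zero _
  have h1 : (q 1 fun _ => y) = fderiv ℝ G 0 y := by
    rw [hq.fderiv_eq, continuousMultilinearCurryFin1_apply]
    congr 1
  have : q.partialSum 2 y = ∑ j ∈ Finset.range 2, q j fun _ => y := rfl
  rw [zero_add, this, Finset.sum_range_succ, Finset.sum_range_one, h0, h1]

/-- An analytic self-map of `ℝ³` fixing `0` agrees with a quadratic polynomial map up to third
order, and so do the derivatives up to second order. -/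
theorem AnalyticAt.exists_quadMap {Φ : (Fin 3 → ℝ) → (Fin 3 → ℝ)} (hΦ : AnalyticAt ℝ Φ 0)
    (h0 : Φ 0 = 0) : ∃ a b,
      fderiv ℝ (quadMap a b) 0 = fderiv ℝ Φ 0 ∧
      (fun y => fderiv ℝ Φ y - fderiv ℝ (quadMap a b) y) =O[𝓝 0] (fun y => ‖y‖ ^ 2) ∧
      (fun y => Φ y - quadMap a b y) =O[𝓝 0] (fun y => ‖y‖ ^ 3) := by
  set L := fderiv ℝ Φ 0 with hL
  set Q := fderiv ℝ (fderiv ℝ Φ) 0 with hQ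
  have hsymm : ∀ v w, Q v w = Q w v := fun v w =>
    (hΦ.contDiffAt (n := 2)).isSymmSndFDerivAt (by simp) v w
  let e : Fin 3 → Fin 3 → ℝ := fun j => Pi.single j 1
  let a : Fin 3 → Fin 3 → ℝ := fun i j => L (e j) i
  let b : Fin 3 → Fin 3 → Fin 3 → ℝ := fun i j k => 1 / 2 * Q (e j) (e k) i
  have hexp : ∀ (M : (Fin 3 → ℝ) →L[ℝ] (Fin 3 → ℝ)) v i, M v i = ∑ j, M (e j) i * v j := by
    intro M v i
    have hv : v = ∑ j, v j • e j := by
      ext i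
      simp [e, Finset.sum_apply, Pi.single_apply]
    conv_lhs => rw [hv]
    rw [map_sum, Finset.sum_apply]
    refine Finset.sum_congr rfl fun j _ => ?_
    rw [map_smul, Pi.smul_apply, smul_eq_mul, mul_comm]
  have hexpQ : ∀ v w i, Q v w i = ∑ j, ∑ k, Q (e j) (e k) i * (v j * w k) := by
    intro v w i
    have h1 : Q v w i = ∑ j, Q (e j) w i * v j := by
      have := hexp (Q.flip w) v i
      simpa using this
    rw [h1]
    refine Finset.sum_congr rfl fun j _ => ?_
    rw [hexp (Q (e j)) w i, Finset.sum_mul]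
    refine Finset.sum_congr rfl fun k _ => ?_
    ring
  have hder : ∀ y, fderiv ℝ (quadMap a b) y = L + Q y := by
    intro y
    ext v i
    have hquad : ∑ j, ∑ k, b i j k * (v j * y k + y j * v k) = Q y v i := by
      have h2 : Q y v i = 1 / 2 * (Q v y i + Q y v i) := by
        rw [hsymm v y]
        ring
      rw [h2, hexpQ v y, hexpQ y v, ← Finset.sum_add_distrib, Finset.mul_sum]
      refine Finset.sum_congr rfl fun j _ => ?_
      rw [← Finset.sum_add_distrib, Finset.mul_sum]
      refine Finset.sum_congr rfl fun k _ => ?_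
      simp only [b]
      ring
    rw [fderiv_quadMap, add_apply, Pi.add_apply, hexp L v i, ← hquad]
  have hO : (fun y => fderiv ℝ Φ y - fderiv ℝ (quadMap a b) y) =O[𝓝 0] fun y => ‖y‖ ^ 2 :=
    hΦ.fderiv.isBigO_sub_linear.congr_left fun y => by rw [hder]
  refine ⟨a, b, by rw [hder, map_zero, add_zero], hO, ?_⟩
  have hdΦ : ∀ᶠ y in 𝓝 0, DifferentiableAt ℝ Φ y :=
    hΦ.eventually_analyticAt.mono fun y hy => hy.differentiableAt
  have hdq : ∀ y, DifferentiableAt ℝ (quadMap a b) y := fun y =>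
    (analyticAt_quadMap a b y).differentiableAt
  refine isBigO_of_isBigO_fderiv (by rw [h0, quadMap_zero, sub_zero])
    (hdΦ.mono fun y hy => hy.sub (hdq y)) (hO.congr' ?_ EventuallyEq.rfl)
  filter_upwards [hdΦ] with y hy
  rw [fderiv_fun_sub hy (hdq y)]

end Taylor

section Complexification

open Asymptotics Filter

/-- The inclusion of `ℝⁿ` into `ℂⁿ`. -/
noncomputable def realIncl (n : ℕ) : (Fin n → ℝ) →L[ℝ] (Fin n → ℂ) :=
  ContinuousLinearMap.pi fun i => Complex.ofRealCLM.comp (ContinuousLinearMap.proj i)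

theorem realIncl_apply {n : ℕ} (x : Fin n → ℝ) : realIncl n x = fun i => (x i : ℂ) := rfl

theorem norm_realIncl {n : ℕ} (x : Fin n → ℝ) : ‖realIncl n x‖ = ‖x‖ := by
  simp [realIncl_apply, Pi.norm_def]

/-- The order of vanishing at `0` of a holomorphic map can be measured at the real points. -/
theorem isBigO_of_isBigO_realIncl {n m : ℕ} {E : Type*} [NormedAddCommGroup E] [NormedSpace ℂ E]
    [CompleteSpace E] {h : (Fin n → ℂ) → E} (hh : AnalyticAt ℂ h 0)
    (hr : (fun x => h (realIncl n x)) =O[𝓝 0] fun x => ‖x‖ ^ m) :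
    h =O[𝓝 0] fun y => ‖y‖ ^ m := by
  obtain ⟨p, hp⟩ := hh
  have hz : ∀ j, j < m → ∀ y, homPart p j y = 0 := by
    intro j
    induction j using Nat.strong_induction_on with
    | _ j ih =>
      intro hj
      have h1 : (fun y => h y - homPart p j y) =O[𝓝 0] fun y => ‖y‖ ^ (j + 1) := by
        refine (hp.isBigO_sub_partialSum_pow (j + 1)).congr_left fun y => ?_
        have : p.partialSum (j + 1) y = ∑ i ∈ Finset.range (j + 1), homPart p i y := rfl
        rw [zero_add, this, Finset.sum_range_succ, Finset.sum_eq_zero fun i hi =>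
          ih i (Finset.mem_range.1 hi) ((Finset.mem_range.1 hi).trans hj) y, zero_add]
      have ht : Tendsto (realIncl n) (𝓝 0) (𝓝 0) := by
        simpa using (realIncl n).continuous.tendsto 0
      have h2 : (fun x => h (realIncl n x) - homPart p j (realIncl n x)) =O[𝓝 0]
          fun x => ‖x‖ ^ (j + 1) := by
        refine (h1.comp_tendsto ht).congr_right fun x => ?_
        simp [norm_realIncl]
      have h3 : (fun x => h (realIncl n x)) =O[𝓝 0] fun x => ‖x‖ ^ (j + 1) := by
        refine hr.trans (IsBigO.of_bound 1 ?_)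
        filter_upwards [Metric.ball_mem_nhds (0 : Fin n → ℝ) one_pos] with x hx
        rw [one_mul, Real.norm_of_nonneg (by positivity), Real.norm_of_nonneg (by positivity)]
        exact pow_le_pow_of_le_one (norm_nonneg _) (mem_ball_zero_iff.1 hx).le hj
      let q := ((p j).restrictScalars ℝ).compContinuousLinearMap fun _ => realIncl n
      have h4 : (fun x => q fun _ => x) =O[𝓝 0] fun x => ‖x‖ ^ (j + 1) := by
        refine (h3.sub h2).congr_left fun x => ?_
        rw [sub_sub_cancel]
        rfl
      exact eq_zero_of_forall_real (homPart_differentiable p j) fun x =>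
        h4.continuousMultilinearMap_apply_eq_zero x
  refine (hp.isBigO_sub_partialSum_pow m).congr_left fun y => ?_
  have : p.partialSum m y = ∑ i ∈ Finset.range m, homPart p i y := rfl
  rw [zero_add, this, Finset.sum_eq_zero fun i hi => hz i (Finset.mem_range.1 hi) y, sub_zero]

theorem quadMap_realIncl (a : Fin 3 → Fin 3 → ℝ) (b : Fin 3 → Fin 3 → Fin 3 → ℝ)
    (x : Fin 3 → ℝ) :
    quadMap (fun i j => (a i j : ℂ)) (fun i j k => (b i j k : ℂ)) (realIncl 3 x) =
      realIncl 3 (quadMap a b x) := by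
  ext i
  simp [quadMap, realIncl_apply]

theorem fderiv_quadMap_realIncl (a : Fin 3 → Fin 3 → ℝ) (b : Fin 3 → Fin 3 → Fin 3 → ℝ)
    (x v : Fin 3 → ℝ) :
    fderiv ℂ (quadMap (fun i j => (a i j : ℂ)) fun i j k => (b i j k : ℂ)) (realIncl 3 x)
      (realIncl 3 v) = realIncl 3 (fderiv ℝ (quadMap a b) x v) := by
  rw [fderiv_quadMap, fderiv_quadMap]
  ext i
  simp [realIncl_apply]

theorem isInvertible_fderiv_quadMap {a : Fin 3 → Fin 3 → ℝ} {b : Fin 3 → Fin 3 → Fin 3 → ℝ}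
    (h : (fderiv ℝ (quadMap a b) 0).IsInvertible) :
    (fderiv ℂ (quadMap (fun i j => (a i j : ℂ)) fun i j k => (b i j k : ℂ)) 0).IsInvertible := by
  set M := fderiv ℂ (quadMap (fun i j => (a i j : ℂ)) fun i j k => (b i j k : ℂ)) 0 with hM
  have hinj : Function.Injective M := by
    rw [injective_iff_map_eq_zero]
    intro v hv
    have hreal : ∀ w : Fin 3 → ℝ, (∀ i, ∑ j, a i j * w j = 0) → w = 0 := by
      intro w hw
      obtain ⟨N, hN⟩ := h
      refine N.injective ?_
      rw [map_zero, ← ContinuousLinearEquiv.coe_coe, hN, fderiv_quadMap]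
      ext i
      simpa using hw i
    have hcomp : ∀ i, ∑ j, (a i j : ℂ) * v j = 0 := fun i => by
      have := congrFun hv i
      rw [hM, fderiv_quadMap] at this
      simpa using this
    have hre := hreal (fun j => (v j).re) fun i => by
      simpa using congrArg Complex.re (hcomp i)
    have him := hreal (fun j => (v j).im) fun i => by
      simpa using congrArg Complex.im (hcomp i)
    ext j
    exact Complex.ext (congrFun hre j) (congrFun him j)
  exact ⟨(LinearEquiv.ofInjectiveEndo (M : (Fin 3 → ℂ) →ₗ[ℂ] (Fin 3 → ℂ))
    hinj).toContinuousLinearEquiv, by ext v; rfl⟩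

/-- A complexified system with given normal form coefficients is brought to quadratic normal form
by a polynomial map. -/
theorem exists_complex_normalizing_map {f : (Fin 3 → ℝ) → (Fin 3 → ℝ)} {ω α₁ α₂ α₃ α₄ : ℝ}
    (hf : AnalyticAt ℝ f 0) (hnf : HasNormalFormCoefficients f ω α₁ α₂ α₃ α₄)
    {fC : (Fin 3 → ℂ) → (Fin 3 → ℂ)} (hfC : IsComplexification f fC) :
    ∃ T : (Fin 3 → ℂ) → (Fin 3 → ℂ), (∀ y, AnalyticAt ℂ T y) ∧ T 0 = 0 ∧
      (fderiv ℂ T 0).IsInvertible ∧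
      (fun y => fC (T y) - fderiv ℂ T y (((ω : ℂ) • rotGen) y + normalFormQuad α₁ α₂ α₃ α₄ y))
        =O[𝓝 0] fun y => ‖y‖ ^ 3 := by
  obtain ⟨Φ, hΦ, hΦ0, hinv, hΦO⟩ := hnf
  obtain ⟨a, b, hder, hDO, hO⟩ := hΦ.exists_quadMap hΦ0
  set N := truncatedNormalForm ω α₁ α₂ α₃ α₄ with hN
  have hN0 : N 0 = 0 := by
    ext i
    fin_cases i <;> simp [hN, truncatedNormalForm]
  have hNd : DifferentiableAt ℝ N 0 := by
    refine differentiableAt_pi.2 fun i => ?_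
    fin_cases i
    · simp only [hN, truncatedNormalForm]
      simp
      fun_prop
    · simp only [hN, truncatedNormalForm]
      simp
      fun_prop
    · simp only [hN, truncatedNormalForm]
      simp
      fun_prop
  have hNO : N =O[𝓝 0] fun y => ‖y‖ := by
    have := hNd.isBigO_sub
    simpa [hN0] using this.norm_right
  have hTt : Tendsto (quadMap a b) (𝓝 0) (𝓝 0) := by
    have := (analyticAt_quadMap a b 0).continuousAt.tendsto
    rwa [quadMap_zero] at this
  have hΦt : Tendsto Φ (𝓝 0) (𝓝 0) := by
    have := hΦ.continuousAt.tendsto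
    rwa [hΦ0] at this
  have hreal : (fun y => f (quadMap a b y) - fderiv ℝ (quadMap a b) y (N y)) =O[𝓝 0]
      fun y => ‖y‖ ^ 3 := by
    have h1 : (fun y => f (quadMap a b y) - f (Φ y)) =O[𝓝 0] fun y => ‖y‖ ^ 3 := by
      have h := hf.hasStrictFDerivAt.isBigO_sub.comp_tendsto (hTt.prodMk_nhds hΦt)
      refine h.trans (hO.neg_left.congr_left fun y => ?_)
      simp
    have h2 : (fun y => (fderiv ℝ Φ y - fderiv ℝ (quadMap a b) y) (N y)) =O[𝓝 0]
        fun y => ‖y‖ ^ 3 := by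
      refine IsBigO.trans ?_ ((hDO.norm_left.mul hNO.norm_left).congr_right fun y =>
        show ‖y‖ ^ 2 * ‖y‖ = ‖y‖ ^ 3 by ring)
      refine IsBigO.of_bound 1 (Eventually.of_forall fun y => ?_)
      rw [one_mul, Real.norm_of_nonneg (by positivity)]
      exact ContinuousLinearMap.le_opNorm _ _
    refine ((h1.add hΦO).add h2).congr_left fun y => ?_
    rw [sub_apply]
    abel
  let aC : Fin 3 → Fin 3 → ℂ := fun i j => a i j
  let bC : Fin 3 → Fin 3 → Fin 3 → ℂ := fun i j k => b i j k
  refine ⟨quadMap aC bC, analyticAt_quadMap aC bC, quadMap_zero aC bC,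
    isInvertible_fderiv_quadMap (hder ▸ hinv), ?_⟩
  refine isBigO_of_isBigO_realIncl ?_ ?_
  · refine AnalyticAt.sub ?_ ?_
    · refine AnalyticAt.fun_comp ?_ (analyticAt_quadMap aC bC 0)
      rw [quadMap_zero]
      exact hfC.1
    · have hN : AnalyticAt ℂ
          (fun y => ((ω : ℂ) • rotGen) y + normalFormQuad α₁ α₂ α₃ α₄ y) 0 :=
        (((ω : ℂ) • rotGen).analyticAt 0).fun_add (analyticAt_normalFormQuad α₁ α₂ α₃ α₄ 0)
      exact ((analyticAt_quadMap aC bC 0).fderiv.contDiffAt.clm_apply hN.contDiffAt).analyticAt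
  · have hincl : (fun x => realIncl 3 (f (quadMap a b x) - fderiv ℝ (quadMap a b) x (N x)))
        =O[𝓝 0] fun x => ‖x‖ ^ 3 :=
      IsBigO.trans (IsBigO.of_bound 1 (Eventually.of_forall fun x => by
        rw [norm_realIncl, one_mul])) hreal
    refine hincl.congr' ?_ EventuallyEq.rfl
    filter_upwards [hTt.eventually hfC.2] with x hx
    have hNC : ((ω : ℂ) • rotGen) (realIncl 3 x) + normalFormQuad α₁ α₂ α₃ α₄ (realIncl 3 x) =
        realIncl 3 (N x) := by
      rw [smul_apply, rotGen_apply]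
      ext i
      fin_cases i
      · simp [realIncl_apply, hN, truncatedNormalForm, normalFormQuad]
        ring
      · simp [realIncl_apply, hN, truncatedNormalForm, normalFormQuad]
        ring
      · simp [realIncl_apply, hN, truncatedNormalForm, normalFormQuad]
    rw [hNC, fderiv_quadMap_realIncl, quadMap_realIncl, map_sub]
    congr 1
    exact hx.symm

end Complexification

/-! ### Transport of the integrability data -/

section Pullback

open Asymptotics Filter VectorField

variable {n : ℕ} {T : (Fin n → ℂ) → (Fin n → ℂ)}

theorem eventually_isInvertible_fderiv (hT : AnalyticAt ℂ T 0)
    (hinv : (fderiv ℂ T 0).IsInvertible) : ∀ᶠ y in 𝓝 0, (fderiv ℂ T y).IsInvertible := by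
  obtain ⟨e, he⟩ := hinv
  have := hT.fderiv.continuousAt.tendsto
  rw [← he] at this
  exact this.eventually e.nhds

theorem analyticAt_pullback (hT : AnalyticAt ℂ T 0) (hinv : (fderiv ℂ T 0).IsInvertible)
    {W : (Fin n → ℂ) → (Fin n → ℂ)} (hW : AnalyticAt ℂ W (T 0)) :
    AnalyticAt ℂ (pullback ℂ T W) 0 := by
  have h1 : ContDiffAt ℂ ⊤ (fun y => (fderiv ℂ T y).inverse) 0 :=
    ContDiffAt.comp 0 hinv.contDiffAt_map_inverse hT.fderiv.contDiffAt
  exact (h1.clm_apply (hW.comp hT).contDiffAt).analyticAt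

/-- A vector field that is conjugate to `N` by `T` up to third order has pullback `N` up to third
order. -/
theorem pullback_sub_isBigO (hT : AnalyticAt ℂ T 0) (hinv : (fderiv ℂ T 0).IsInvertible)
    {W N : (Fin n → ℂ) → (Fin n → ℂ)}
    (hN : (fun y => W (T y) - fderiv ℂ T y (N y)) =O[𝓝 0] fun y => ‖y‖ ^ 3) :
    (fun y => pullback ℂ T W y - N y) =O[𝓝 0] fun y => ‖y‖ ^ 3 := by
  have h1 : ContinuousAt (fun y => (fderiv ℂ T y).inverse) 0 :=
    (ContDiffAt.comp (n := 1) 0 hinv.contDiffAt_map_inverse hT.fderiv.contDiffAt).continuousAt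
  have h2 : (fun y => (fderiv ℂ T y).inverse (W (T y) - fderiv ℂ T y (N y))) =O[𝓝 0]
      fun y => ‖y‖ ^ 3 := by
    refine IsBigO.trans ?_ (((h1.tendsto.isBigO_one ℝ).norm_left.mul hN.norm_left).congr_right
      fun y => one_mul _)
    refine IsBigO.of_bound 1 (Eventually.of_forall fun y => ?_)
    rw [one_mul, Real.norm_of_nonneg (by positivity)]
    exact ContinuousLinearMap.le_opNorm _ _
  refine h2.congr' ?_ EventuallyEq.rfl
  filter_upwards [eventually_isInvertible_fderiv hT hinv] with y hy
  rw [map_sub, hy.inverse_apply_self]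
  rfl

/-- A property that holds almost everywhere on a neighbourhood of `0` holds at points arbitrarily
close to `0`. -/
theorem exists_of_ae_restrict {U : Set (Fin n → ℂ)} (hU : IsOpen U) (h0 : 0 ∈ U)
    {P Q : (Fin n → ℂ) → Prop} (hP : ∀ᵐ x ∂(volume.restrict U), P x) (hQ : ∀ᶠ x in 𝓝 0, Q x) :
    ∃ x, P x ∧ Q x := by
  have hd := Measure.dense_of_ae ((ae_restrict_iff' hU.measurableSet).1 hP)
  have hf := mem_closure_iff_frequently.1 (hd 0)
  obtain ⟨x, hx, hxU, hxQ⟩ := (hf.and_eventually ((hU.eventually_mem h0).and hQ)).exists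
  exact ⟨x, hx hxU, hxQ⟩

theorem eventually_of_eventually_comp (hT : AnalyticAt ℂ T 0) (hT0 : T 0 = 0)
    (hinv : (fderiv ℂ T 0).IsInvertible) {Q : (Fin n → ℂ) → Prop}
    (h : ∀ᶠ y in 𝓝 0, Q (T y)) : ∀ᶠ x in 𝓝 0, Q x := by
  obtain ⟨e, he⟩ := hinv
  have hs := hT.hasStrictFDerivAt
  rw [← he] at hs
  have := hs.map_nhds_eq_of_equiv
  rw [hT0] at this
  rw [← this]
  exact h

end Pullback

open VectorField in
theorem mainTheorem7
    (f : (Fin 3 → ℝ) → (Fin 3 → ℝ)) (ω : ℝ) (hf : IsFoldHopfSystem f ω)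
    (α₁ α₂ α₃ α₄ : ℝ) (hnf : HasNormalFormCoefficients f ω α₁ α₂ α₃ α₄)
    (hα : ¬ (α₁ = 0 ∧ α₃ = 0 ∧ α₄ = 0))
    (fC : (Fin 3 → ℂ) → (Fin 3 → ℂ)) (hfC : IsComplexification f fC)
    (hint : AnalyticallyIntegrableNearZero 3 fC) :
    AnalyticallyIntegrableNearZero 2 (truncatedPlanarField α₁ α₃ α₄) := by
  obtain ⟨hfa, -, hω0, -⟩ := hf
  have hω : (ω : ℂ) ≠ 0 := by exact_mod_cast hω0.ne'
  obtain ⟨T, hTa, hT0, hinv, hTO⟩ := exists_complex_normalizing_map hfa hnf hfC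
  obtain ⟨U, m, p, v, F, hU, h0U, hmp, hv, hF, hvf, hvli, hcomm, hFli, hvF⟩ := hint
  have hTU : ∀ᶠ y in 𝓝 0, T y ∈ U := by
    have h := (hTa 0).continuousAt.tendsto
    rw [hT0] at h
    exact h.eventually (hU.mem_nhds h0U)
  have hTinv := eventually_isInvertible_fderiv (hTa 0) hinv
  have h0T : T 0 ∈ U := by rwa [hT0]
  have hwa : ∀ j, AnalyticAt ℂ (pullback ℂ T (v j)) 0 := fun j =>
    analyticAt_pullback (hTa 0) hinv (hv j _ h0T)
  have hY := pullback_sub_isBigO (W := v 0) (hTa 0) hinv (hTO.congr' (by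
    filter_upwards [hTU] with y hy
    rw [hvf hy]) Filter.EventuallyEq.rfl)
  rcases p with _ | p
  · obtain rfl : m = 2 := by lia
    refine planar_integrable_of_three_commuting hω hα (hwa 0) hY hwa (fun j => ?_) fun c hc h => ?_
    · filter_upwards [hTU] with y hy
      have hb := pullback_lieBracket (𝕜 := ℂ) (n := 2) (by simp) (f := T) (x := y)
        (hTa y).contDiffAt (hv 0 _ hy).differentiableAt (hv j _ hy).differentiableAt
      rw [pullback, hcomm 0 j _ hy, map_zero, lieBracket_eq] at hb
      exact sub_eq_zero.1 hb.symm
    · have hcv : ∀ᶠ y in 𝓝 0, ∑ j, c j • v j (T y) = 0 := by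
        filter_upwards [h, hTinv] with y hy hyinv
        have h2 := congrArg (fderiv ℂ T y) hy
        rw [map_sum, map_zero] at h2
        rw [← h2]
        refine Finset.sum_congr rfl fun j _ => ?_
        rw [map_smul, fderiv_pullback T (v j) y hyinv]
      obtain ⟨x, hx, hxc⟩ := exists_of_ae_restrict hU h0U hvli
        (eventually_of_eventually_comp (Q := fun x => ∑ j, c j • v j x = 0) (hTa 0) hT0 hinv hcv)
      exact hc (funext (Fintype.linearIndependent_iff.1 hx c hxc))
  · have hFT : ∀ᶠ y in 𝓝 0, DifferentiableAt ℂ (F 0) (T y) := by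
      filter_upwards [hTU] with y hy using (hF 0 _ hy).differentiableAt
    refine planar_integrable_of_analytic_firstIntegral hω hα hY (F := fun y => F 0 (T y))
      ((hF 0 _ h0T).fun_comp (hTa 0)) (fun h => ?_) ?_
    · have hconst := eventually_of_eventually_comp (Q := fun x => F 0 x = F 0 (T 0))
        (hTa 0) hT0 hinv h
      obtain ⟨x, hx, hxc⟩ := exists_of_ae_restrict hU h0U hFli hconst.eventually_nhds
      refine hx.ne_zero 0 ?_
      have : F 0 =ᶠ[𝓝 x] fun _ => F 0 (T 0) := hxc
      rw [this.fderiv_eq, fderiv_fun_const]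
      rfl
    · filter_upwards [hTU, hTinv, hFT] with y hy hyinv hyF
      have hd : HasFDerivAt (fun y => F 0 (T y)) ((fderiv ℂ (F 0) (T y)).comp (fderiv ℂ T y)) y :=
        hyF.hasFDerivAt.comp y (hTa y).differentiableAt.hasFDerivAt
      rw [hd.fderiv, ContinuousLinearMap.comp_apply, fderiv_pullback T (v 0) y hyinv]
      exact hvF 0 0 _ hy
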